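/- Let $p$ be a prime, let $\mathbb{Z}_p$ be the ring (or additive group) of $p$-adic integers, and let $q_1=2,q_2=3,q_3=5,\ldots$ be the primes in increasing order. For $m\ge 1$ let $$G_m = C\ltimes (A_1\times\cdots\times A_m),$$ where $C=\overline{\langle y\rangle}\cong\mathbb{Z}_p$, where each $A_j\cong\mathbb{Z}_p^{\,q_j}$ is normal in $G_m$, freely generated as a $\mathbb{Z}_p$-module by $x_{j,1},\ldots,x_{j,q_j}$, and where $C$ acts continuously on $A_j$ by $[x_{j,k},y]=x_{j,k}^{-1}y^{-1}x_{j,k}\,y=x_{j,k+1}$ for $1\le k\le q_j-1$ and $[x_{j,q_j},y]=x_{j,1}^{\,p}$. For a topologically finitely generated pro-$p$ group $G$, the lower $p$-series $\mathcal{L}$ is given by $P_1(G)=G$ and $P_{i+1}(G)=\overline{P_i(G)^p[P_i(G),G]}$; the Hausdorff dimension of a closed subgroup $H$ of an infinite such $G$ is $\mathrm{hdim}_G^{\mathcal{L}}(H)=\liminf_{i\to\infty}\log_p|HP_i(G):P_i(G)|/\log_p|G:P_i(G)|$; and $\mathrm{hspec}^{\mathcal{L}}(G)$ is the set of the values $\mathrm{hdim}_G^{\mathcal{L}}(H)$,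 where $H$ runs over all closed subgroups of $G$. If $G$ is $p$-adic analytic, i.e. has a uniformly powerful open subgroup, then $\dim(G)$ is the minimal number of topological generators of such a subgroup. Then, for every $m\ge 1$: 1. $G_m$ is a metabelian $p$-adic analytic pro-$p$ group, and $\dim(G_m)=1+\sum_{j=1}^m q_j$. 2. For all closed subgroups $B_j\le A_j$ of dimension (that is, $\mathbb{Z}_p$-rank) $d_j$, $1\le j\le m$, $$\mathrm{hdim}_{G_m}^{\mathcal{L}}(B_1\times\cdots\times B_m)=\frac{d_1/q_1+\cdots+d_m/q_m}{m+1}.$$ 3. $\mathrm{hspec}^{\mathcal{L}}(G_m)$ is finite, and $$\prod_{j=1}^m q_j\ \le\ \bigl|\mathrm{hspec}^{\mathcal{L}}(G_m)\bigr|\ \le\ 2\prod_{j=1}^m(q_j+1).$$ Moreover, as $m\to\infty$, $$\log\bigl|\mathrm{hspec}^{\mathcal{L}}(G_m)\bigr|\ \sim\ \log\prod_{j=1}^m q_j\qquad\text{and}\qquad \frac{\log_p\bigl|\mathrm{hspec}^{\mathcal{L}}(G_m)\bigr|}{\sqrt{\dim(G_m)}}\ \to\ \infty .$$ -/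

import Mathlib

open Filter Topology

namespace HSpec

section TopologicalGroups

variable (p : ℕ) (G : Type*) [Group G] [TopologicalSpace G] [IsTopologicalGroup G]

/-- A pro-`p` group: a profinite group all of whose open normal subgroups have `p`-power index. -/
structure IsProP : Prop where
  compactSpace : CompactSpace G
  t2Space : T2Space G
  totallyDisconnectedSpace : TotallyDisconnectedSpace G
  index_eq_pow : ∀ U : Subgroup G, U.Normal → IsOpen (U : Set G) → ∃ k : ℕ, U.index = p ^ k

/-- The lower `p`-series, indexed from `0`: `lowerPSeries p G i` is `P_{i+1}(G)`, where
`P_1(G) = G` and `P_{i+1}(G)` is the closure of `P_i(G)^p [P_i(G), G]`. -/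
def lowerPSeries : ℕ → Subgroup G
  | 0 => ⊤
  | i + 1 =>
    (Subgroup.closure ((fun g : G => g ^ p) '' (lowerPSeries i : Set G)) ⊔
      ⁅lowerPSeries i, (⊤ : Subgroup G)⁆).topologicalClosure

/-- The sizes of the finite subsets that generate `G` topologically. -/
def topGenCards : Set ℕ :=
  {n | ∃ S : Finset G, S.card = n ∧ (Subgroup.closure (S : Set G)).topologicalClosure = ⊤}

/-- The minimal number of topological generators (meaningful if `G` is topologically finitely
generated). -/
noncomputable def topRank : ℕ := sInf (topGenCards G)

/-- Powerful: `G / closure (G ^ p)` is abelian if `p` is odd, `G / closure (G ^ 4)` is abelian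
if `p = 2`. -/
def IsPowerful : Prop :=
  commutator G ≤
    (Subgroup.closure (Set.range fun g : G => g ^ (if p = 2 then 4 else p))).topologicalClosure

/-- Uniformly powerful pro-`p` groups: finitely generated, powerful, and with all sections
`P_i(G) / P_{i+1}(G)` of the same order. -/
structure IsUniform : Prop where
  isProP : IsProP p G
  finitelyGenerated : (topGenCards G).Nonempty
  isPowerful : IsPowerful p G
  relIndex_eq : ∀ i : ℕ,
    (lowerPSeries p G (i + 1)).relIndex (lowerPSeries p G i) = (lowerPSeries p G 1).index

/-- The ranks of the uniformly powerful open subgroups of `G`. -/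
def uniformRanks : Set ℕ :=
  {d | ∃ U : Subgroup G, IsOpen (U : Set G) ∧ IsUniform p U ∧ topRank U = d}

/-- A pro-`p` group is `p`-adic analytic if and only if it has a uniformly powerful open
subgroup. -/
structure IsPadicAnalyticProP : Prop where
  isProP : IsProP p G
  exists_uniform : (uniformRanks p G).Nonempty

/-- The dimension of a `p`-adic analytic pro-`p` group: the rank of a uniformly powerful open
subgroup. -/
noncomputable def padicDim : ℕ := sInf (uniformRanks p G)

variable {G}

/-- The Hausdorff dimension of `H` with respect to a series `S` of open normal subgroups of finite
index: the lower limit of `log_p |H S_i : S_i| / log_p |G : S_i|`. All but finitely many of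
these quotients lie in `[0, 1]` when `G` is infinite and `S` intersects trivially. -/
noncomputable def hdim (S : ℕ → Subgroup G) (H : Subgroup G) : ℝ :=
  liminf (fun i : ℕ =>
    Real.logb p ((S i).relIndex (H ⊔ S i) : ℝ) / Real.logb p ((S i).index : ℝ)) atTop

variable (G)

/-- The Hausdorff spectrum of `G` with respect to the lower `p`-series. -/
noncomputable def hspec : Set ℝ :=
  {x | ∃ H : Subgroup G, IsClosed (H : Set G) ∧ hdim p (lowerPSeries p G) H = x}

end TopologicalGroups

section Block

variable (p : ℕ) [Fact p.Prime]

/-- The `ℤ_p`-linear map `N` on `ℤ_p ^ q` with `N x_k = x_{k+1}` for `k` not the last index, and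
`N x_k = p x_1` for the last `k` (here the basis is indexed from `0`). -/
noncomputable def blockShift (q : ℕ) : (Fin q → ℤ_[p]) →ₗ[ℤ_[p]] (Fin q → ℤ_[p]) :=
  (Pi.basisFun ℤ_[p] (Fin q)).constr ℤ_[p] fun k : Fin q =>
    if h : k.val + 1 < q then Pi.single ⟨k.val + 1, h⟩ 1
    else Pi.single ⟨0, k.pos⟩ (p : ℤ_[p])

variable {p} {q : ℕ}

lemma blockShift_single (k : Fin q) : blockShift p q (Pi.single k 1) =
    if h : k.val + 1 < q then Pi.single ⟨k.val + 1, h⟩ 1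
    else Pi.single ⟨0, k.pos⟩ (p : ℤ_[p]) := by
  rw [← Pi.basisFun_apply, blockShift, Module.Basis.constr_basis]

lemma blockShift_pow_single_zero (hq : 0 < q) (k : ℕ) (hk : k < q) :
    (blockShift p q ^ k) (Pi.single ⟨0, hq⟩ 1) = Pi.single ⟨k, hk⟩ 1 := by
  induction k with
  | zero => simp
  | succ k ih =>
    rw [pow_succ', Module.End.mul_apply, ih (by omega), blockShift_single, dif_pos hk]

lemma blockShift_pow_self : blockShift p q ^ q = (p : ℤ_[p]) • 1 := by
  rcases Nat.eq_zero_or_pos q with rfl | hq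
  · exact LinearMap.ext fun v => Subsingleton.elim _ _
  have h0 : (blockShift p q ^ q) (Pi.single ⟨0, hq⟩ 1) = (p : ℤ_[p]) • Pi.single ⟨0, hq⟩ 1 := by
    obtain ⟨r, rfl⟩ : ∃ r, q = r + 1 := ⟨q - 1, by omega⟩
    rw [pow_succ', Module.End.mul_apply, blockShift_pow_single_zero hq r (by omega),
      blockShift_single, dif_neg (by simp), ← Pi.single_smul, smul_eq_mul, mul_one]
  refine (Pi.basisFun ℤ_[p] (Fin q)).ext fun k => ?_
  rw [Pi.basisFun_apply, ← blockShift_pow_single_zero hq k.val k.isLt, ← Module.End.mul_apply,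
    ← pow_add, add_comm, pow_add, Module.End.mul_apply, h0, map_smul]
  rfl

lemma tendsto_blockShift_pow (v : Fin q → ℤ_[p]) :
    Tendsto (fun n : ℕ => (blockShift p q ^ n) v) atTop (𝓝 0) := by
  rcases Nat.eq_zero_or_pos q with rfl | hq
  · exact tendsto_const_nhds.congr fun n => Subsingleton.elim _ _
  have hdiv : Tendsto (fun n : ℕ => n / q) atTop atTop := Nat.tendsto_div_const_atTop hq.ne'
  have hp : Tendsto (fun n : ℕ => ‖(p : ℤ_[p])‖ ^ (n / q)) atTop (𝓝 0) :=
    (tendsto_pow_atTop_nhds_zero_of_lt_one (norm_nonneg _) (by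
      rw [PadicInt.norm_p]; exact inv_lt_one_of_one_lt₀ (mod_cast (Fact.out : p.Prime).one_lt))).comp hdiv
  refine squeeze_zero_norm (fun n => ?_) hp
  have : (blockShift p q ^ n) v = (p : ℤ_[p]) ^ (n / q) • (blockShift p q ^ (n % q)) v := by
    conv_lhs => rw [← Nat.div_add_mod n q, pow_add, pow_mul, blockShift_pow_self, smul_pow,
      one_pow]
    simp
  rw [this]
  refine (norm_smul_le _ _).trans ?_
  rw [norm_pow]
  exact mul_le_of_le_one_right (by positivity)
    ((pi_norm_le_iff_of_nonneg zero_le_one).2 fun i => PadicInt.norm_le_one _)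

/-- The action of `z ∈ ℤ_p` on `ℤ_p ^ q` by `(1 + N) ^ z = ∑ n, (z choose n) N ^ n`. -/
noncomputable def blockActFun (z : ℤ_[p]) (v : Fin q → ℤ_[p]) : Fin q → ℤ_[p] :=
  PadicInt.mahlerSeries (fun n : ℕ => (blockShift p q ^ n) v) z

lemma continuous_blockActFun_left (v : Fin q → ℤ_[p]) :
    Continuous fun z : ℤ_[p] => blockActFun z v :=
  map_continuous (PadicInt.mahlerSeries fun n : ℕ => (blockShift p q ^ n) v)

lemma blockActFun_natCast (n : ℕ) (v : Fin q → ℤ_[p]) :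
    blockActFun (n : ℤ_[p]) v = ((1 + blockShift p q) ^ n) v := by
  rw [blockActFun, PadicInt.mahlerSeries_apply_nat (tendsto_blockShift_pow v) le_rfl,
    add_comm (1 : Module.End ℤ_[p] (Fin q → ℤ_[p])),
    (Commute.one_right (blockShift p q)).add_pow, LinearMap.sum_apply]
  refine Finset.sum_congr rfl fun i _ => ?_
  rw [one_pow, mul_one, ← Nat.cast_comm, ← nsmul_eq_mul, LinearMap.smul_apply]

/-- `blockActFun z` as a `ℤ_p`-linear map. -/
noncomputable def blockAct (z : ℤ_[p]) : (Fin q → ℤ_[p]) →ₗ[ℤ_[p]] (Fin q → ℤ_[p]) where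
  toFun := blockActFun z
  map_add' v w := by
    refine congr_fun (PadicInt.denseRange_natCast.equalizer (continuous_blockActFun_left (v + w))
      ((continuous_blockActFun_left v).add (continuous_blockActFun_left w))
      (funext fun n => ?_)) z
    simp [blockActFun_natCast]
  map_smul' c v := by
    refine congr_fun (PadicInt.denseRange_natCast.equalizer (continuous_blockActFun_left (c • v))
      ((continuous_blockActFun_left v).const_smul c) (funext fun n => ?_)) z
    simp [blockActFun_natCast]

lemma blockAct_apply (z : ℤ_[p]) (v : Fin q → ℤ_[p]) : blockAct z v = blockActFun z v := rfl

lemma blockAct_natCast (n : ℕ) : blockAct (n : ℤ_[p]) = (1 + blockShift p q) ^ n :=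
  LinearMap.ext fun v => blockActFun_natCast n v

lemma blockAct_zero : blockAct (0 : ℤ_[p]) = (1 : Module.End ℤ_[p] (Fin q → ℤ_[p])) := by
  simpa using blockAct_natCast (p := p) (q := q) 0

lemma blockAct_one : blockAct (1 : ℤ_[p]) = 1 + blockShift p q := by
  simpa using blockAct_natCast (p := p) (q := q) 1

lemma continuous_blockAct :
    Continuous fun x : ℤ_[p] × (Fin q → ℤ_[p]) => blockAct x.1 x.2 := by
  have h (x : ℤ_[p] × (Fin q → ℤ_[p])) :
      blockAct x.1 x.2 = ∑ k, x.2 k • blockActFun x.1 (Pi.single k 1) := by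
    simp only [← blockAct_apply]
    exact LinearMap.pi_apply_eq_sum_univ (blockAct x.1) x.2 |>.trans
      (Finset.sum_congr rfl fun k _ => by congr; ext j; simp [Pi.single_apply, eq_comm])
  simp only [h]
  exact continuous_finsetSum _ fun k _ =>
    ((continuous_apply k).comp continuous_snd).smul
      ((continuous_blockActFun_left _).comp continuous_fst)

lemma blockAct_add (a b : ℤ_[p]) (v : Fin q → ℤ_[p]) :
    blockAct (a + b) v = blockAct a (blockAct b v) := by
  have hl : Continuous fun x : ℤ_[p] × ℤ_[p] => blockAct (x.1 + x.2) v :=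
    (continuous_blockActFun_left v).comp continuous_add
  have hr : Continuous fun x : ℤ_[p] × ℤ_[p] => blockAct x.1 (blockAct x.2 v) :=
    continuous_blockAct.comp
      (continuous_fst.prodMk ((continuous_blockActFun_left v).comp continuous_snd))
  refine congr_fun ((PadicInt.denseRange_natCast.prodMap PadicInt.denseRange_natCast).equalizer
    hl hr (funext fun ⟨m, n⟩ => ?_)) (a, b)
  simp only [Function.comp_apply, Prod.map_apply, ← Nat.cast_add, blockAct_natCast, pow_add,
    Module.End.mul_apply]

end Block

section Group

/-- `blockRank j` is the `j`-th prime, counted from `0`: `2, 3, 5, …`. -/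
noncomputable def blockRank (j : ℕ) : ℕ := Nat.nth Nat.Prime j

variable (p : ℕ) [Fact p.Prime] (m : ℕ)

/-- The direct product `A_1 × … × A_m`, where `A_j = ℤ_p ^ {q_j}`. -/
abbrev Blocks : Type := (j : Fin m) → Fin (blockRank j) → ℤ_[p]

/-- Conjugation `a ↦ z a z⁻¹` of `z ∈ C` on the product of the blocks. As `y⁻¹ a y` is `(1 + N) a`
for the generator `y` of `C`, this is `(1 + N) ^ (-z)` on every block. -/
noncomputable def conjBlocks : Multiplicative ℤ_[p] →* MulAut (Multiplicative (Blocks p m)) where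
  toFun z :=
    { toFun := fun a => .ofAdd fun j => blockAct (-z.toAdd) (a.toAdd j)
      invFun := fun a => .ofAdd fun j => blockAct z.toAdd (a.toAdd j)
      left_inv := fun a => by
        refine Multiplicative.toAdd.injective (funext fun j => ?_)
        simp [← blockAct_add, blockAct_zero]
      right_inv := fun a => by
        refine Multiplicative.toAdd.injective (funext fun j => ?_)
        simp [← blockAct_add, blockAct_zero]
      map_mul' := fun a b => by
        refine Multiplicative.toAdd.injective (funext fun j => ?_)
        simp }
  map_one' := by
    refine MulEquiv.ext fun a => Multiplicative.toAdd.injective (funext fun j => ?_)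
    simp [blockAct_zero]
  map_mul' z w := by
    refine MulEquiv.ext fun a => Multiplicative.toAdd.injective (funext fun j => ?_)
    simp only [MulAut.mul_apply, MulEquiv.coe_mk, Equiv.coe_fn_mk, toAdd_ofAdd, toAdd_mul,
      neg_add, blockAct_add]

/-- The group `G_m = C ⋉ (A_1 × … × A_m)`. -/
abbrev GrpG : Type := Multiplicative (Blocks p m) ⋊[conjBlocks p m] Multiplicative ℤ_[p]

/-- The topology of `G_m` is the product topology of `(A_1 × … × A_m) × C`. -/
noncomputable instance : TopologicalSpace (GrpG p m) :=
  TopologicalSpace.induced SemidirectProduct.equivProd inferInstance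

variable {p m}

lemma continuous_left : Continuous fun g : GrpG p m => g.left :=
  continuous_fst.comp
    (continuous_induced_dom (f := (SemidirectProduct.equivProd : GrpG p m ≃ _)))

lemma continuous_right : Continuous fun g : GrpG p m => g.right :=
  continuous_snd.comp
    (continuous_induced_dom (f := (SemidirectProduct.equivProd : GrpG p m ≃ _)))

lemma continuous_grpG_mk {X : Type*} [TopologicalSpace X] {f : X → Multiplicative (Blocks p m)}
    {g : X → Multiplicative ℤ_[p]} (hf : Continuous f) (hg : Continuous g) :
    Continuous fun x => (⟨f x, g x⟩ : GrpG p m) :=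
  continuous_induced_rng.2 (hf.prodMk hg)

lemma continuous_conjBlocks {X : Type*} [TopologicalSpace X] {f : X → Multiplicative (Blocks p m)}
    {g : X → Multiplicative ℤ_[p]} (hf : Continuous f) (hg : Continuous g) :
    Continuous fun x => conjBlocks p m (g x) (f x) := by
  have hf' : Continuous fun x => (f x).toAdd := continuous_toAdd.comp hf
  have hg' : Continuous fun x => -(g x).toAdd := (continuous_toAdd.comp hg).neg
  have h : Continuous fun x => (fun j => blockAct (-(g x).toAdd) ((f x).toAdd j) : Blocks p m) :=
    continuous_pi fun j =>
      continuous_blockAct.comp (hg'.prodMk ((continuous_apply j).comp hf'))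
  exact continuous_ofAdd.comp h

variable (p m)

instance : IsTopologicalGroup (GrpG p m) where
  continuous_mul := by
    have l₁ : Continuous fun x : GrpG p m × GrpG p m => x.1.left :=
      continuous_left.comp continuous_fst
    have l₂ : Continuous fun x : GrpG p m × GrpG p m => x.2.left :=
      continuous_left.comp continuous_snd
    have r₁ : Continuous fun x : GrpG p m × GrpG p m => x.1.right :=
      continuous_right.comp continuous_fst
    have r₂ : Continuous fun x : GrpG p m × GrpG p m => x.2.right :=
      continuous_right.comp continuous_snd
    exact continuous_grpG_mk (l₁.mul (continuous_conjBlocks l₂ r₁)) (r₁.mul r₂)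
  continuous_inv := by
    have l : Continuous fun x : GrpG p m => x.left := continuous_left
    have r : Continuous fun x : GrpG p m => x.right := continuous_right
    exact continuous_grpG_mk (continuous_conjBlocks l.inv r.inv) r.inv

/-- The generator `y` of `C`. -/
noncomputable def genY : GrpG p m := SemidirectProduct.inr (.ofAdd 1)

variable {m}

/-- The generators `x_{j,k}` of `A_j`, with `k` indexed from `0`. -/
noncomputable def genX (j : Fin m) (k : Fin (blockRank j)) : GrpG p m :=
  SemidirectProduct.inl (.ofAdd (Pi.single j (Pi.single k 1)))

/-- The defining relations: `[x_{j,k}, y]` is `x_{j,k+1}` or `x_{j,1} ^ p`. -/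
lemma genX_comm_genY (j : Fin m) (k : Fin (blockRank j)) :
    (genX p j k)⁻¹ * (genY p m)⁻¹ * genX p j k * genY p m =
      if h : k.val + 1 < blockRank j then genX p j ⟨k.val + 1, h⟩
      else genX p j ⟨0, k.pos⟩ ^ p := by
  have key : (genY p m)⁻¹ * genX p j k * genY p m = SemidirectProduct.inl
      (.ofAdd (Pi.single j (Pi.single k 1 + blockShift p _ (Pi.single k 1)))) := by
    have h := SemidirectProduct.inl_aut_inv (φ := conjBlocks p m) (.ofAdd 1)
      (.ofAdd (Pi.single j (Pi.single k 1)))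
    rw [map_inv] at h
    rw [genX, genY, ← h]
    congr 1
    refine Multiplicative.toAdd.injective (funext fun i => ?_)
    change blockAct 1 (Pi.single (M := fun j : Fin m => Fin (blockRank j) → ℤ_[p]) j
      (Pi.single k 1) i) = _
    by_cases hi : i = j
    · subst hi
      simp [blockAct_one]
    · simp [hi]
  rw [mul_assoc, mul_assoc, ← mul_assoc (genY p m)⁻¹, key, genX, ← map_inv, ← map_mul,
    blockShift_single]
  have hx : ∀ v w : Fin (blockRank j) → ℤ_[p],
      (Multiplicative.ofAdd (Pi.single j v : Blocks p m))⁻¹ *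
        Multiplicative.ofAdd (Pi.single j (v + w) : Blocks p m) =
        Multiplicative.ofAdd (Pi.single j w : Blocks p m) := by
    intro v w
    rw [Pi.single_add, ofAdd_add, inv_mul_cancel_left]
  rw [hx]
  split_ifs with h
  · rfl
  · rw [genX, ← map_pow, ← ofAdd_nsmul, ← Pi.single_smul, ← Pi.single_smul]
    simp

/-- The subgroup `B_1 × … × B_m` of `G_m`, for closed subgroups `B_j` of `A_j`, that is,
`ℤ_p`-submodules. -/
noncomputable def prodSubgroup (B : (j : Fin m) → Submodule ℤ_[p] (Fin (blockRank j) → ℤ_[p])) :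
    Subgroup (GrpG p m) :=
  (AddSubgroup.toSubgroup (Submodule.pi Set.univ B).toAddSubgroup).map SemidirectProduct.inl

end Group

end HSpec

namespace HSpec

open scoped commutatorElement

section Index

@[to_additive]
lemma index_eq_map_mul_ker {G Q : Type*} [Group G] [Group Q] (f : G →* Q) (K : Subgroup G)
    [K.Normal] : K.index = (K.map f).relIndex f.range * K.relIndex f.ker := by
  rw [← Subgroup.relIndex_sup_right f.ker K, MonoidHom.range_eq_map, Subgroup.relIndex_map_map,
    top_sup_eq, Subgroup.relIndex_top_right, sup_comm, mul_comm,
    Subgroup.relIndex_mul_index le_sup_right]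

@[to_additive]
lemma relIndex_eq_map_mul_ker {G Q : Type*} [Group G] [Group Q] (f : G →* Q) (K H : Subgroup G)
    [(K.subgroupOf H).Normal] :
    K.relIndex H = ((K ⊓ H).map f).relIndex (H.map f) * K.relIndex (H ⊓ f.ker) := by
  have h := index_eq_map_mul_ker (f.comp H.subtype) (K.subgroupOf H)
  have h1 : (K.subgroupOf H).map (f.comp H.subtype) = (K ⊓ H).map f := by
    rw [← Subgroup.map_map, Subgroup.subgroupOf_map_subtype]
  have h2 : (f.comp H.subtype).range = H.map f := by
    rw [MonoidHom.range_comp, Subgroup.range_subtype]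
  have h3 : (f.comp H.subtype).ker = f.ker.subgroupOf H := rfl
  rw [h1, h2, h3] at h
  rw [Subgroup.relIndex, h]
  congr 1
  conv_rhs => rw [← Subgroup.relIndex_subgroupOf (inf_le_left : H ⊓ f.ker ≤ H)]
  rw [Subgroup.inf_subgroupOf_left]

end Index

section PadicModules

variable {p : ℕ} [Fact p.Prime]

lemma index_range_pow {M : Type*} [AddCommGroup M] [Module ℤ_[p] M] (f : Module.End ℤ_[p] M)
    (hf : Function.Injective f) (n : ℕ) :
    (LinearMap.range (f ^ n)).toAddSubgroup.index =
      (LinearMap.range f).toAddSubgroup.index ^ n := by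
  induction n with
  | zero => simp [Module.End.one_eq_id]
  | succ n ih =>
    have h : (LinearMap.range (f ^ (n + 1))).toAddSubgroup =
        (LinearMap.range (f ^ n)).toAddSubgroup.map f.toAddMonoidHom := by
      rw [pow_succ', Module.End.mul_eq_comp, LinearMap.range_comp]; rfl
    rw [h, AddSubgroup.index_map_of_injective _ (f := f.toAddMonoidHom) hf, ih, pow_succ]
    rfl

lemma index_ker_pi_toZMod {ι : Type*} [Fintype ι] {M : Type*} [AddCommGroup M]
    (g : M →+ (ι → ℤ_[p])) (hg : Function.Surjective g) (K : AddSubgroup M)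
    (hK : ∀ v, v ∈ K ↔ ∀ i, (p : ℤ_[p]) ∣ g v i) : K.index = p ^ Fintype.card ι := by
  let φ : M →+ (ι → ZMod p) := (AddMonoidHom.compLeft
    (PadicInt.toZMod (p := p)).toAddMonoidHom ι).comp g
  have hφ : Function.Surjective φ := by
    intro w
    choose x hx using fun i => ZMod.ringHom_surjective (PadicInt.toZMod (p := p)) (w i)
    obtain ⟨v, hv⟩ := hg x
    exact ⟨v, funext fun i => by simp [φ, hv, hx]⟩
  have hker : K = φ.ker := by
    ext v
    rw [hK, AddMonoidHom.mem_ker, funext_iff]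
    refine forall_congr' fun i => ?_
    change _ ↔ PadicInt.toZMod (g v i) = 0
    rw [← RingHom.mem_ker, PadicInt.ker_toZMod, PadicInt.maximalIdeal_eq_span_p,
      Ideal.mem_span_singleton]
  rw [hker, AddSubgroup.index_ker, AddMonoidHom.range_eq_top.2 hφ]
  simp [Nat.card_pi]

lemma index_range_pow_smul (M : Type*) [AddCommGroup M] [Module ℤ_[p] M] [Module.Free ℤ_[p] M]
    [Module.Finite ℤ_[p] M] (n : ℕ) :
    (LinearMap.range (((p : ℤ_[p]) • (1 : Module.End ℤ_[p] M)) ^ n)).toAddSubgroup.index =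
      p ^ (Module.finrank ℤ_[p] M * n) := by
  have hp : (p : ℤ_[p]) ≠ 0 := mod_cast (Fact.out : p.Prime).ne_zero
  let b := Module.finBasis ℤ_[p] M
  rw [index_range_pow _ (fun v w h => smul_right_injective M hp (by simpa using h)),
    index_ker_pi_toZMod b.equivFun.toAddEquiv.toAddMonoidHom b.equivFun.surjective, ← pow_mul,
    Fintype.card_fin]
  intro v
  constructor
  · rintro ⟨w, rfl⟩ i
    exact ⟨b.equivFun w i, by simp⟩
  · intro h
    choose x hx using h
    refine ⟨b.equivFun.symm x, b.equivFun.injective (funext fun i => ?_)⟩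
    rw [LinearMap.smul_apply, Module.End.one_apply, map_smul, LinearEquiv.apply_symm_apply]
    exact (hx i).symm

lemma relIndex_pow_smul {M : Type*} [AddCommGroup M] [Module ℤ_[p] M] [Module.Free ℤ_[p] M]
    [Module.Finite ℤ_[p] M] (D : Submodule ℤ_[p] M) (n : ℕ) :
    (D.map (((p : ℤ_[p]) • (1 : Module.End ℤ_[p] M)) ^ n)).toAddSubgroup.relIndex
      D.toAddSubgroup = p ^ (Module.finrank ℤ_[p] D * n) := by
  rw [← index_range_pow_smul D n, AddSubgroup.relIndex]
  congr 1
  ext ⟨v, hv⟩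
  simp only [smul_pow, one_pow, AddSubgroup.mem_addSubgroupOf, Submodule.mem_toAddSubgroup,
    Submodule.mem_map, LinearMap.mem_range]
  constructor
  · rintro ⟨w, hw, h⟩
    exact ⟨⟨w, hw⟩, Subtype.ext h⟩
  · rintro ⟨w, h⟩
    exact ⟨w, w.2, congrArg Subtype.val h⟩

lemma exists_pow_smul_mem (M : Type*) [AddCommGroup M] [Module ℤ_[p] M]
    [Module.Finite ℤ_[p] M] (D : Submodule ℤ_[p] M) :
    ∃ r : ℕ, ∀ (n : ℕ) (v : M), (p : ℤ_[p]) ^ (n + r) • v ∈ D → (p : ℤ_[p]) ^ r • v ∈ D := by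
  let g : ℕ →o Submodule ℤ_[p] M :=
    ⟨fun n => D.comap ((p : ℤ_[p]) ^ n • (1 : Module.End ℤ_[p] M)), fun a b hab v hv => by
      obtain ⟨c, rfl⟩ := Nat.exists_eq_add_of_le' hab
      simp only [Submodule.mem_comap, LinearMap.smul_apply, Module.End.one_apply] at hv ⊢
      rw [pow_add, mul_smul]
      exact D.smul_mem _ hv⟩
  obtain ⟨r, hr⟩ := monotone_stabilizes_iff_noetherian.2
    (inferInstance : IsNoetherian ℤ_[p] M) g
  refine ⟨r, fun n v hv => ?_⟩
  have : v ∈ g (n + r) := hv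
  rw [← hr (n + r) (by omega)] at this
  exact this

lemma logb_bounds_of_dvd {a b x : ℕ} (ha : p ^ a ∣ x) (hb : x ∣ p ^ b) :
    0 < x ∧ (a : ℝ) ≤ Real.logb p x ∧ Real.logb p x ≤ b := by
  have hp : 1 < (p : ℝ) := mod_cast (Fact.out : p.Prime).one_lt
  have hpb : 0 < p ^ b := pow_pos (Fact.out : p.Prime).pos b
  have hx : 0 < x := Nat.pos_of_dvd_of_pos hb hpb
  refine ⟨hx, ?_, ?_⟩
  · rw [Real.le_logb_iff_rpow_le hp (mod_cast hx), Real.rpow_natCast]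
    exact_mod_cast Nat.le_of_dvd hx ha
  · rw [Real.logb_le_iff_le_rpow hp (mod_cast hx), Real.rpow_natCast]
    exact_mod_cast Nat.le_of_dvd hpb hb

/-- An additive subgroup between `p ^ (n + 1) D` and `p ^ n M` has an index in `D` of the expected
size. -/
lemma exists_logb_relIndex_bound {M : Type*} [AddCommGroup M] [Module ℤ_[p] M]
    [Module.Free ℤ_[p] M] [Module.Finite ℤ_[p] M] (D : Submodule ℤ_[p] M) :
    ∃ C : ℝ, ∀ (n : ℕ) (E : AddSubgroup M), (∀ v ∈ D, (p : ℤ_[p]) ^ (n + 1) • v ∈ E) →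
      (∀ v ∈ E, v ∈ D → ∃ w, v = (p : ℤ_[p]) ^ n • w) →
      0 < E.relIndex D.toAddSubgroup ∧
      |Real.logb p (E.relIndex D.toAddSubgroup) - Module.finrank ℤ_[p] D * n| ≤ C := by
  obtain ⟨r, hr⟩ := exists_pow_smul_mem M D
  set d := Module.finrank ℤ_[p] D
  refine ⟨d * (r + 1), fun n E h1 h2 => ?_⟩
  have hb : E.relIndex D.toAddSubgroup ∣ p ^ (d * (n + 1)) := by
    rw [← relIndex_pow_smul D (n + 1)]
    refine AddSubgroup.relIndex_dvd_of_le_left _ ?_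
    rintro _ ⟨v, hv, rfl⟩
    simpa [smul_pow] using h1 v hv
  have ha : p ^ (d * (n - r)) ∣ E.relIndex D.toAddSubgroup := by
    rw [← relIndex_pow_smul D (n - r), ← AddSubgroup.inf_relIndex_right E]
    refine AddSubgroup.relIndex_dvd_of_le_left _ ?_
    rintro v ⟨hvE, hvD⟩
    change v ∈ D at hvD
    rcases le_total n r with hnr | hnr
    · rw [Nat.sub_eq_zero_of_le hnr]
      exact ⟨v, hvD, by simp⟩
    · obtain ⟨w, rfl⟩ := h2 v hvE hvD
      obtain ⟨k, rfl⟩ := Nat.exists_eq_add_of_le' hnr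
      refine ⟨(p : ℤ_[p]) ^ r • w, hr k w hvD, ?_⟩
      simp [smul_pow, smul_smul, pow_add, mul_comm]
  obtain ⟨h0, hl, hu⟩ := logb_bounds_of_dvd ha hb
  refine ⟨h0, abs_le.2 ⟨?_, ?_⟩⟩
  · have h3 : (n : ℝ) ≤ (n - r : ℕ) + r := mod_cast (by omega)
    push_cast at hl
    nlinarith [(Nat.cast_nonneg d : (0 : ℝ) ≤ d)]
  · push_cast at hu
    nlinarith [mul_nonneg (Nat.cast_nonneg d : (0 : ℝ) ≤ d) (Nat.cast_nonneg r : (0 : ℝ) ≤ r)]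

end PadicModules

section Slices

variable {p : ℕ} [Fact p.Prime] {m : ℕ} {q : Fin m → ℕ}

variable (p q) in
/-- The vectors whose components before the `k`-th vanish. -/
noncomputable def tailSubmodule (k : ℕ) : Submodule ℤ_[p] ((j : Fin m) → Fin (q j) → ℤ_[p]) where
  carrier := {v | ∀ j : Fin m, j.val < k → v j = 0}
  zero_mem' := fun _ _ => rfl
  add_mem' := fun ha hb j hj => by simp [ha j hj, hb j hj]
  smul_mem' := fun c v hv j hj => by simp [hv j hj]

/-- The `j`-th components of the vectors in `B` whose previous components vanish. -/
noncomputable def sliceSubmodule (B : Submodule ℤ_[p] ((j : Fin m) → Fin (q j) → ℤ_[p]))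
    (j : Fin m) : Submodule ℤ_[p] (Fin (q j) → ℤ_[p]) :=
  (B ⊓ tailSubmodule p q j).map (LinearMap.proj j)

lemma sliceSubmodule_pi (B : (j : Fin m) → Submodule ℤ_[p] (Fin (q j) → ℤ_[p])) (j : Fin m) :
    sliceSubmodule (Submodule.pi Set.univ B) j = B j := by
  ext v
  constructor
  · rintro ⟨w, hw, rfl⟩
    exact hw.1 j trivial
  · intro hv
    refine ⟨Pi.single j v, ⟨fun k _ => ?_, fun k hk => ?_⟩, by simp⟩
    · rcases eq_or_ne k j with rfl | h
      · simpa using hv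
      · simp [h]
    · rw [Pi.single_eq_of_ne (by rintro rfl; omega)]

lemma finrank_sliceSubmodule_le (B : Submodule ℤ_[p] ((j : Fin m) → Fin (q j) → ℤ_[p]))
    (j : Fin m) : Module.finrank ℤ_[p] (sliceSubmodule B j) ≤ q j := by
  simpa using (sliceSubmodule B j).finrank_le

lemma relIndex_eq_prod_slices (B : Submodule ℤ_[p] ((j : Fin m) → Fin (q j) → ℤ_[p]))
    (W : AddSubgroup ((j : Fin m) → Fin (q j) → ℤ_[p])) :
    W.relIndex B.toAddSubgroup =
      ∏ j : Fin m, ((W ⊓ (B ⊓ tailSubmodule p q j).toAddSubgroup).map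
        (LinearMap.proj (R := ℤ_[p]) j).toAddMonoidHom).relIndex
          (sliceSubmodule B j).toAddSubgroup := by
  let c : ℕ → ℕ := fun k => if h : k < m then
    ((W ⊓ (B ⊓ tailSubmodule p q k).toAddSubgroup).map
        (LinearMap.proj (R := ℤ_[p]) (⟨k, h⟩ : Fin m)).toAddMonoidHom).relIndex
          (sliceSubmodule B ⟨k, h⟩).toAddSubgroup else 1
  have key : ∀ k ≤ m, W.relIndex B.toAddSubgroup =
      (∏ j ∈ Finset.range k, c j) * W.relIndex (B ⊓ tailSubmodule p q k).toAddSubgroup := by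
    intro k hk
    induction k with
    | zero =>
      have : tailSubmodule p q 0 = ⊤ := eq_top_iff.2 fun v _ j hj => absurd hj (Nat.not_lt_zero _)
      simp [this]
    | succ k ih =>
      rw [ih (by omega), Finset.prod_range_succ, mul_assoc]
      congr 1
      rw [relIndex_eq_map_add_ker (LinearMap.proj (R := ℤ_[p]) (⟨k, hk⟩ : Fin m)).toAddMonoidHom]
      simp only [c, dif_pos (show k < m from hk)]
      congr 2
      ext v
      constructor
      · rintro ⟨⟨h1, h2⟩, h3⟩
        refine ⟨h1, fun j hj => ?_⟩
        rcases Nat.lt_succ_iff_lt_or_eq.1 hj with h | h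
        · exact h2 j h
        · obtain rfl : j = ⟨k, hk⟩ := Fin.ext h
          exact h3
      · rintro ⟨h1, h2⟩
        exact ⟨⟨h1, fun j hj => h2 j (by omega)⟩, h2 ⟨k, hk⟩ (Nat.lt_succ_self k)⟩
  have htail : B ⊓ tailSubmodule p q m = ⊥ :=
    (Submodule.eq_bot_iff _).2 fun v hv => funext fun j => hv.2 j j.2
  rw [key m le_rfl, htail, Finset.prod_range]
  simp [c]

/-- For a filtration that divides the `j`-th component by about `p ^ (n / q j)`, the index of its
`n`-th term in a submodule is governed by the ranks of the slices. -/
lemma exists_logb_relIndex_slices (hq : ∀ j, 0 < q j)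
    (B : Submodule ℤ_[p] ((j : Fin m) → Fin (q j) → ℤ_[p])) :
    ∃ C : ℝ, ∀ (n : ℕ) (W : AddSubgroup ((j : Fin m) → Fin (q j) → ℤ_[p])),
      (∀ v ∈ W, ∀ j, ∃ w, v j = (p : ℤ_[p]) ^ (n / q j) • w) →
      (∀ (j : Fin m), ∀ v ∈ tailSubmodule p q j, (p : ℤ_[p]) ^ (n / q j + 1) • v ∈ W) →
      0 < W.relIndex B.toAddSubgroup ∧
      |Real.logb p (W.relIndex B.toAddSubgroup) -
        n * ∑ j, (Module.finrank ℤ_[p] (sliceSubmodule B j) : ℝ) / q j| ≤ C := by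
  choose C hC using fun j => exists_logb_relIndex_bound (sliceSubmodule B j)
  refine ⟨∑ j, (C j + Module.finrank ℤ_[p] (sliceSubmodule B j)), fun n W h1 h2 => ?_⟩
  have h (j : Fin m) := hC j (n / q j) ((W ⊓ (B ⊓ tailSubmodule p q j).toAddSubgroup).map
        (LinearMap.proj (R := ℤ_[p]) j).toAddMonoidHom) (by
      rintro _ ⟨v, hv, rfl⟩
      exact ⟨_, ⟨h2 j v hv.2, Submodule.smul_mem _ _ hv⟩, rfl⟩) (by
      rintro _ ⟨v, hv, rfl⟩ -
      exact h1 v hv.1 j)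
  rw [relIndex_eq_prod_slices]
  refine ⟨Finset.prod_pos fun j _ => (h j).1, ?_⟩
  rw [Nat.cast_prod, Real.logb_prod _ _ (fun j _ => Nat.cast_ne_zero.2 (h j).1.ne'), Finset.mul_sum,
    ← Finset.sum_sub_distrib]
  refine (Finset.abs_sum_le_sum_abs _ _).trans (Finset.sum_le_sum fun j _ => ?_)
  have hqj : (0 : ℝ) < q j := mod_cast hq j
  set d : ℝ := (Module.finrank ℤ_[p] (sliceSubmodule B j) : ℝ)
  have hd : 0 ≤ d := Nat.cast_nonneg _
  have h3 : ((n / q j : ℕ) : ℝ) ≤ n / q j := Nat.cast_div_le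
  have h4 : (n : ℝ) / q j ≤ (n / q j : ℕ) + 1 := by
    rw [div_le_iff₀ hqj]
    rw [mul_comm]; exact_mod_cast (Nat.lt_mul_div_succ n (hq j)).le
  have h5 : (n : ℝ) * (d / q j) = d * (n / q j) := by ring
  have h6 := abs_le.1 (h j).2
  rw [h5, abs_le]
  constructor <;> nlinarith

end Slices

section ActFiltrations

variable {p : ℕ} [Fact p.Prime]

lemma isClosed_submodule {M : Type*} [AddCommGroup M] [Module ℤ_[p] M] [TopologicalSpace M]
    [T2Space M] [ContinuousAdd M] [ContinuousSMul ℤ_[p] M] [Module.Finite ℤ_[p] M]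
    (D : Submodule ℤ_[p] M) : IsClosed (D : Set M) := by
  obtain ⟨n, s, hs⟩ := Submodule.fg_iff_exists_fin_generating_family.1
    (IsNoetherian.noetherian D)
  have h : (D : Set M) = Set.range fun c : Fin n → ℤ_[p] => ∑ i, c i • s i := by
    rw [← hs, ← Fintype.range_linearCombination]
    rfl
  rw [h]
  exact (isCompact_range (by fun_prop)).isClosed

/-- A closed additive subgroup of a topological `ℤ_p`-module is a submodule. -/
def closedSubmodule {M : Type*} [AddCommGroup M] [Module ℤ_[p] M] [TopologicalSpace M]
    [ContinuousSMul ℤ_[p] M] (D : AddSubgroup M) (hD : IsClosed (D : Set M)) :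
    Submodule ℤ_[p] M where
  __ := D
  smul_mem' c v hv := by
    have hc : IsClosed {c : ℤ_[p] | c • v ∈ D} :=
      hD.preimage (continuous_id.smul continuous_const)
    refine hc.closure_subset_iff.2 ?_ (PadicInt.denseRange_natCast c)
    rintro _ ⟨n, rfl⟩
    change (n : ℤ_[p]) • v ∈ D
    rw [Nat.cast_smul_eq_nsmul]
    exact D.nsmul_mem hv n

variable (p) (m : ℕ)

/-- The map `N` on the product of the blocks. -/
noncomputable def shift : Module.End ℤ_[p] (Blocks p m) :=
  LinearMap.pi fun j => blockShift p _ ∘ₗ LinearMap.proj j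

variable {p m}

/-- The action `(1 + N) ^ z` on the product of the blocks. -/
noncomputable def act (z : ℤ_[p]) : Module.End ℤ_[p] (Blocks p m) :=
  LinearMap.pi fun j => blockAct z ∘ₗ LinearMap.proj j

lemma shift_pow_apply (n : ℕ) (v : Blocks p m) (j : Fin m) :
    (shift p m ^ n) v j = (blockShift p _ ^ n) (v j) := by
  induction n generalizing v with
  | zero => rfl
  | succ n ih => rw [pow_succ, Module.End.mul_apply, ih, pow_succ, Module.End.mul_apply]; rfl

lemma act_apply (z : ℤ_[p]) (v : Blocks p m) (j : Fin m) : act z v j = blockAct z (v j) := rfl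

lemma act_zero : act (0 : ℤ_[p]) = (1 : Module.End ℤ_[p] (Blocks p m)) :=
  LinearMap.ext fun v => funext fun j => by simp [act_apply, blockAct_zero]

lemma act_one : act (1 : ℤ_[p]) = 1 + shift p m :=
  LinearMap.ext fun v => funext fun j => by simp [act_apply, blockAct_one, shift]

lemma act_add (a b : ℤ_[p]) (v : Blocks p m) : act (a + b) v = act a (act b v) :=
  funext fun j => blockAct_add a b (v j)

lemma continuous_act : Continuous fun x : ℤ_[p] × Blocks p m => act x.1 x.2 :=
  continuous_pi fun j => continuous_blockAct.comp
    (continuous_fst.prodMk ((continuous_apply j).comp continuous_snd))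

/-- Filtrations of the product of the blocks on which `p ^ s ℤ_p` acts unipotently. -/
structure IsActFiltration (L : ℕ → Submodule ℤ_[p] (Blocks p m)) (s : ℕ) : Prop where
  zero : L 0 = ⊤
  succ_le : ∀ k, L (k + 1) ≤ L k
  smul_mem : ∀ k, ∀ v ∈ L k, (p : ℤ_[p]) • v ∈ L (k + 1)
  act_sub_mem : ∀ k z, (p : ℤ_[p]) ^ s ∣ z → ∀ v ∈ L k, act z v - v ∈ L (k + 1)
  act_mem : ∀ k z, ∀ v ∈ L k, act z v ∈ L k

lemma IsActFiltration.sum_act_mem {L : ℕ → Submodule ℤ_[p] (Blocks p m)} {s : ℕ}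
    (hL : IsActFiltration L s) {k : ℕ} {z : ℤ_[p]} (hz : (p : ℤ_[p]) ^ s ∣ z) {v : Blocks p m}
    (hv : v ∈ L k) : ∑ t ∈ Finset.range p, act ((t : ℤ_[p]) * z) v ∈ L (k + 1) := by
  have h : ∑ t ∈ Finset.range p, act ((t : ℤ_[p]) * z) v =
      ∑ t ∈ Finset.range p, (act ((t : ℤ_[p]) * z) v - v) + (p : ℤ_[p]) • v := by
    rw [Finset.sum_sub_distrib, Finset.sum_const, Finset.card_range, Nat.cast_smul_eq_nsmul,
      sub_add_cancel]
  rw [h]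
  exact add_mem (sum_mem fun t _ => hL.act_sub_mem k _ (hz.mul_left _) v hv)
    (hL.smul_mem k v hv)

lemma IsActFiltration.act_sub_mem_add {L : ℕ → Submodule ℤ_[p] (Blocks p m)} {s : ℕ}
    (hL : IsActFiltration L s) {k i : ℕ} {z : ℤ_[p]} (hz : (p : ℤ_[p]) ^ (s + i) ∣ z)
    {v : Blocks p m} (hv : v ∈ L k) : act z v - v ∈ L (k + i + 1) := by
  induction i generalizing z with
  | zero => exact hL.act_sub_mem k z hz v hv
  | succ i ih =>
    obtain ⟨c, rfl⟩ := hz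
    set z := (p : ℤ_[p]) ^ (s + i) * c with hzdef
    have hz : (p : ℤ_[p]) ^ (s + (i + 1)) * c = p * z := by rw [hzdef]; ring
    have h : act ((p : ℤ_[p]) * z) v - v =
        ∑ t ∈ Finset.range p, act ((t : ℤ_[p]) * z) (act z v - v) := by
      have h0 := Finset.sum_range_sub (fun t : ℕ => act ((t : ℤ_[p]) * z) v) p
      simp only [Nat.cast_zero, zero_mul, act_zero, Module.End.one_apply] at h0
      rw [← h0]
      refine Finset.sum_congr rfl fun t _ => ?_
      rw [map_sub, ← act_add]
      push_cast
      ring_nf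
    rw [hz, h]
    exact hL.sum_act_mem (((pow_dvd_pow _ (by omega)).mul_right c)) (ih (Dvd.intro c rfl))

lemma act_sub_mem_range_shift (k : ℕ) (z : ℤ_[p]) (v : Blocks p m)
    (hv : v ∈ LinearMap.range (shift p m ^ k)) :
    act z v - v ∈ LinearMap.range (shift p m ^ (k + 1)) := by
  have hc : IsClosed {z : ℤ_[p] | act z v - v ∈ LinearMap.range (shift p m ^ (k + 1))} :=
    (isClosed_submodule (LinearMap.range (shift p m ^ (k + 1)))).preimage
      ((continuous_act.comp (Continuous.prodMk_left v)).sub continuous_const)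
  refine hc.closure_subset_iff.2 ?_ (PadicInt.denseRange_natCast z)
  rintro _ ⟨n, rfl⟩
  change act (n : ℤ_[p]) v - v ∈ LinearMap.range (shift p m ^ (k + 1))
  obtain ⟨w, rfl⟩ := hv
  induction n with
  | zero => simp [act_zero]
  | succ n ih =>
    set v := (shift p m ^ k) w
    have h : act ((n + 1 : ℕ) : ℤ_[p]) v - v =
        act (n : ℤ_[p]) v - v + shift p m (act (n : ℤ_[p]) v - v) + shift p m v := by
      rw [Nat.cast_succ, add_comm, act_add, act_one, LinearMap.add_apply, Module.End.one_apply,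
        map_sub]
      abel
    rw [h]
    refine add_mem (add_mem ih ?_) ⟨w, by rw [pow_succ']; rfl⟩
    obtain ⟨u, hu⟩ := ih
    exact ⟨shift p m u, by rw [← hu, ← Module.End.mul_apply, ← pow_succ, pow_succ']; rfl⟩

lemma blockRank_prime (j : ℕ) : (blockRank j).Prime := Nat.prime_nth_prime j

lemma range_shift_pow_antitone : Antitone fun k => LinearMap.range (shift p m ^ k) :=
  antitone_nat_of_succ_le fun k => by
    rintro _ ⟨w, rfl⟩
    exact ⟨shift p m w, by rw [pow_succ]; rfl⟩

lemma isActFiltration_shift :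
    IsActFiltration (fun k => LinearMap.range (shift p m ^ k)) 0 where
  zero := by simp [Module.End.one_eq_id]
  succ_le k := range_shift_pow_antitone k.le_succ
  smul_mem k v hv := by
    obtain ⟨w, rfl⟩ := hv
    refine ⟨fun j => (blockShift p _ ^ (blockRank j - 1)) (w j), funext fun j => ?_⟩
    rw [shift_pow_apply, ← Module.End.mul_apply, ← pow_add, Pi.smul_apply, shift_pow_apply,
      show k + 1 + (blockRank j - 1) = k + blockRank j by
        have := (blockRank_prime j).pos; omega, pow_add, blockShift_pow_self]
    simp
  act_sub_mem k z _ v hv := act_sub_mem_range_shift k z v hv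
  act_mem k z v hv := by
    rw [← sub_add_cancel (act z v) v]
    exact add_mem (range_shift_pow_antitone k.le_succ (act_sub_mem_range_shift k z v hv)) hv

lemma shift_pow_div {n : ℕ} {v : Blocks p m} (hv : v ∈ LinearMap.range (shift p m ^ n))
    (j : Fin m) : ∃ w, v j = (p : ℤ_[p]) ^ (n / blockRank j) • w := by
  obtain ⟨u, rfl⟩ := hv
  refine ⟨(blockShift p _ ^ (n % blockRank j)) (u j), ?_⟩
  rw [shift_pow_apply]
  conv_lhs => rw [← Nat.div_add_mod n (blockRank j), pow_add, pow_mul, blockShift_pow_self,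
    smul_pow, one_pow]
  simp

lemma blockShift_pow_mul (q n : ℕ) (v : Fin q → ℤ_[p]) :
    (blockShift p q ^ (q * n)) v = (p : ℤ_[p]) ^ n • v := by
  rw [pow_mul, blockShift_pow_self, smul_pow, one_pow]
  simp

lemma pow_smul_mem_range_shift {n c : ℕ} {v : Blocks p m}
    (h : ∀ j : Fin m, v j = 0 ∨ n ≤ blockRank j * c) :
    (p : ℤ_[p]) ^ c • v ∈ LinearMap.range (shift p m ^ n) := by
  refine ⟨fun j => (blockShift p _ ^ (blockRank j * c - n)) (v j), funext fun j => ?_⟩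
  rw [shift_pow_apply, ← Module.End.mul_apply, ← pow_add, Pi.smul_apply]
  rcases h j with h | h
  · simp [h]
  · rw [Nat.add_sub_of_le h, blockShift_pow_mul]

lemma blockRank_strictMono : StrictMono blockRank :=
  Nat.nth_strictMono Nat.infinite_setOfPred_prime

lemma pow_smul_mem_range_shift_of_tail (n : ℕ) (j : Fin m) (v : Blocks p m)
    (hv : v ∈ tailSubmodule p (fun j : Fin m => blockRank j) j) :
    (p : ℤ_[p]) ^ (n / blockRank j + 1) • v ∈ LinearMap.range (shift p m ^ n) := by
  refine pow_smul_mem_range_shift fun k => ?_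
  by_cases hk : k.val < j.val
  · exact Or.inl (hv k hk)
  · refine Or.inr ((Nat.lt_mul_div_succ n (blockRank_prime j).pos).le.trans ?_)
    exact Nat.mul_le_mul_right _ (blockRank_strictMono.monotone (not_lt.1 hk))

lemma blockShift_injective (q : ℕ) : Function.Injective (blockShift p q) := by
  rcases Nat.eq_zero_or_pos q with rfl | hq
  · exact fun _ _ _ => Subsingleton.elim _ _
  have hp : (p : ℤ_[p]) ≠ 0 := mod_cast (Fact.out : p.Prime).ne_zero
  have h : Function.Injective (blockShift p q ^ q) := by
    rw [blockShift_pow_self]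
    exact fun _ _ h => smul_right_injective _ hp (by simpa using h)
  obtain ⟨r, rfl⟩ : ∃ r, q = r + 1 := ⟨q - 1, by omega⟩
  rw [pow_succ] at h
  exact Function.Injective.of_comp (f := (blockShift p (r + 1) ^ r)) h

lemma shift_injective : Function.Injective (shift p m) := fun _ _ h =>
  funext fun j => blockShift_injective _ (congrFun h j)

lemma blockShift_apply (r : ℕ) (w : Fin (r + 1) → ℤ_[p]) : blockShift p (r + 1) w =
    Fin.cons ((p : ℤ_[p]) * w (Fin.last r)) fun k => w k.castSucc := by
  let B : Module.End ℤ_[p] (Fin (r + 1) → ℤ_[p]) :=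
    { toFun := fun w => Fin.cons ((p : ℤ_[p]) * w (Fin.last r)) fun k => w k.castSucc
      map_add' := fun v w => funext fun i => by
        refine Fin.cases ?_ (fun k => ?_) i <;> simp [mul_add]
      map_smul' := fun c w => funext fun i => by
        refine Fin.cases ?_ (fun k => ?_) i <;> simp [mul_left_comm] }
  suffices h : blockShift p (r + 1) = B from LinearMap.congr_fun h w
  refine (Pi.basisFun ℤ_[p] (Fin (r + 1))).ext fun k => funext fun i => ?_
  rw [Pi.basisFun_apply, blockShift_single]
  change _ = (Fin.cons ((p : ℤ_[p]) * (Pi.single k 1 : Fin (r + 1) → ℤ_[p]) (Fin.last r))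
    (fun l : Fin r => (Pi.single k 1 : Fin (r + 1) → ℤ_[p]) l.castSucc) : Fin (r + 1) → ℤ_[p]) i
  refine Fin.cases ?_ (fun l => ?_) i
  · split_ifs with h
    · have hk : k ≠ Fin.last r := fun hk => by simp [hk] at h
      simp [hk.symm]
    · obtain rfl : k = Fin.last r := Fin.ext (by simp only [Fin.val_last]; omega)
      simp
  · split_ifs with h
    · simp [Pi.single_apply, Fin.ext_iff]
    · simp [Pi.single_apply, Fin.ext_iff, show l.val ≠ k by omega]

lemma mem_range_blockShift {q : ℕ} (hq : 0 < q) (v : Fin q → ℤ_[p]) :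
    v ∈ LinearMap.range (blockShift p q) ↔ (p : ℤ_[p]) ∣ v ⟨0, hq⟩ := by
  obtain ⟨r, rfl⟩ : ∃ r, q = r + 1 := ⟨q - 1, by omega⟩
  constructor
  · rintro ⟨w, rfl⟩
    rw [blockShift_apply]
    exact ⟨w (Fin.last r), rfl⟩
  · rintro ⟨c, hc⟩
    refine ⟨Fin.snoc (fun k => v k.succ) c, funext fun i => ?_⟩
    rw [blockShift_apply]
    refine Fin.cases ?_ (fun l => ?_) i
    · simpa using hc.symm
    · simp

lemma index_range_shift_pow (n : ℕ) :
    (LinearMap.range (shift p m ^ n)).toAddSubgroup.index = p ^ (m * n) := by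
  rw [index_range_pow _ shift_injective, index_ker_pi_toZMod (ι := Fin m)
    (LinearMap.pi (R := ℤ_[p]) fun j : Fin m =>
      (LinearMap.proj (⟨0, (blockRank_prime j).pos⟩ : Fin (blockRank j))) ∘ₗ
        LinearMap.proj (φ := fun j : Fin m => Fin (blockRank j) → ℤ_[p]) j).toAddMonoidHom,
    Fintype.card_fin, pow_mul]
  · exact fun w => ⟨fun j _ => w j, rfl⟩
  · intro v
    change v ∈ LinearMap.range (shift p m) ↔ ∀ i : Fin m, (p : ℤ_[p]) ∣ v i ⟨0, _⟩
    simp only [← mem_range_blockShift]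
    constructor
    · rintro ⟨w, rfl⟩ j
      exact ⟨w j, rfl⟩
    · intro h
      choose w hw using h
      exact ⟨w, funext hw⟩

end ActFiltrations

section GroupStructure

variable {p : ℕ} [Fact p.Prime] {m : ℕ}

/-- The component in `A_1 × … × A_m`, written additively. -/
noncomputable def leftPart (g : GrpG p m) : Blocks p m := g.left.toAdd

/-- The component in `C`, written additively. -/
noncomputable def rightPart (g : GrpG p m) : ℤ_[p] := g.right.toAdd

/-- The inclusion of `A_1 × … × A_m`, written additively. -/
noncomputable def incl (v : Blocks p m) : GrpG p m := SemidirectProduct.inl (.ofAdd v)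

lemma grp_ext {g h : GrpG p m} (h1 : leftPart g = leftPart h) (h2 : rightPart g = rightPart h) :
    g = h := SemidirectProduct.ext (Multiplicative.toAdd.injective h1)
      (Multiplicative.toAdd.injective h2)

@[simp] lemma leftPart_one : leftPart (1 : GrpG p m) = 0 := rfl
@[simp] lemma rightPart_one : rightPart (1 : GrpG p m) = 0 := rfl
@[simp] lemma leftPart_incl (v : Blocks p m) : leftPart (incl v) = v := rfl
@[simp] lemma rightPart_incl (v : Blocks p m) : rightPart (incl v) = 0 := rfl
@[simp] lemma leftPart_inr (z : Multiplicative ℤ_[p]) :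
    leftPart (SemidirectProduct.inr z : GrpG p m) = 0 := rfl
@[simp] lemma rightPart_inr (z : Multiplicative ℤ_[p]) :
    rightPart (SemidirectProduct.inr z : GrpG p m) = z.toAdd := rfl

lemma leftPart_mul (g h : GrpG p m) :
    leftPart (g * h) = leftPart g + act (-rightPart g) (leftPart h) := rfl

lemma rightPart_mul (g h : GrpG p m) : rightPart (g * h) = rightPart g + rightPart h := rfl

lemma leftPart_inv (g : GrpG p m) : leftPart g⁻¹ = -act (rightPart g) (leftPart g) := by
  have : leftPart g⁻¹ = act (-(-rightPart g)) (-leftPart g) := rfl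
  rw [this, neg_neg, map_neg]

lemma rightPart_inv (g : GrpG p m) : rightPart g⁻¹ = -rightPart g := rfl

lemma rightPart_pow (g : GrpG p m) (n : ℕ) : rightPart (g ^ n) = n * rightPart g := by
  induction n with
  | zero => simp
  | succ n ih => rw [pow_succ, rightPart_mul, ih]; push_cast; ring

lemma leftPart_pow (g : GrpG p m) (n : ℕ) :
    leftPart (g ^ n) = ∑ t ∈ Finset.range n, act ((t : ℤ_[p]) * -rightPart g) (leftPart g) := by
  induction n with
  | zero => simp
  | succ n ih =>
    rw [pow_succ, leftPart_mul, ih, Finset.sum_range_succ, rightPart_pow, mul_neg]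

lemma incl_add (v w : Blocks p m) : (incl (v + w) : GrpG p m) = incl v * incl w :=
  map_mul (SemidirectProduct.inl (φ := conjBlocks p m)) (.ofAdd v) (.ofAdd w)

lemma incl_neg (v : Blocks p m) : (incl (-v) : GrpG p m) = (incl v)⁻¹ :=
  map_inv (SemidirectProduct.inl (φ := conjBlocks p m)) (.ofAdd v)

lemma incl_nsmul (n : ℕ) (v : Blocks p m) : (incl (n • v) : GrpG p m) = incl v ^ n :=
  map_pow (SemidirectProduct.inl (φ := conjBlocks p m)) (.ofAdd v) n

lemma incl_leftPart_mul_inr (g : GrpG p m) :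
    incl (leftPart g) * SemidirectProduct.inr (.ofAdd (rightPart g)) = g :=
  SemidirectProduct.inl_left_mul_inr_right g

lemma eq_incl_of_rightPart {g : GrpG p m} (h : rightPart g = 0) : g = incl (leftPart g) :=
  grp_ext rfl h

lemma commutatorElement_eq_incl (g h : GrpG p m) :
    ⁅g, h⁆ = incl ((act (-rightPart g) (leftPart h) - leftPart h) -
      (act (-rightPart h) (leftPart g) - leftPart g)) := by
  rw [commutatorElement_def, mul_inv_eq_iff_eq_mul, mul_inv_eq_iff_eq_mul, mul_assoc]
  refine grp_ext ?_ ?_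
  · simp only [leftPart_mul, leftPart_incl, rightPart_incl, neg_zero, act_zero,
      Module.End.one_apply]
    abel
  · simp only [rightPart_mul, rightPart_incl]
    ring

lemma conj_incl (g : GrpG p m) (v : Blocks p m) :
    g * incl v * g⁻¹ = incl (act (-rightPart g) v) := by
  rw [mul_inv_eq_iff_eq_mul]
  refine grp_ext ?_ ?_
  · simp only [leftPart_mul, leftPart_incl, rightPart_incl, neg_zero, act_zero,
      Module.End.one_apply]
    abel
  · simp only [rightPart_mul, rightPart_incl, zero_add, add_zero]

lemma continuous_leftPart : Continuous (leftPart (p := p) (m := m)) :=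
  continuous_toAdd.comp continuous_left

lemma continuous_rightPart : Continuous (rightPart (p := p) (m := m)) :=
  continuous_toAdd.comp continuous_right

lemma continuous_incl : Continuous (incl (p := p) (m := m)) :=
  continuous_grpG_mk continuous_ofAdd continuous_const

variable (p m) in
/-- The underlying space of `G_m` is a product. -/
noncomputable def grpHomeo : GrpG p m ≃ₜ Multiplicative (Blocks p m) × Multiplicative ℤ_[p] :=
  SemidirectProduct.equivProd.toHomeomorphOfIsInducing ⟨rfl⟩

instance : CompactSpace (GrpG p m) := (grpHomeo p m).symm.compactSpace
instance : T2Space (GrpG p m) := (grpHomeo p m).symm.t2Space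
instance : TotallyDisconnectedSpace (GrpG p m) := (grpHomeo p m).symm.totallyDisconnectedSpace

/-- The subgroup of the elements with components in `L` and in `p ^ k ℤ_p`. -/
def semi (L : Submodule ℤ_[p] (Blocks p m)) (hL : ∀ z, ∀ v ∈ L, act z v ∈ L) (k : ℕ) :
    Subgroup (GrpG p m) where
  carrier := {g | leftPart g ∈ L ∧ (p : ℤ_[p]) ^ k ∣ rightPart g}
  one_mem' := ⟨L.zero_mem, dvd_zero _⟩
  mul_mem' := fun ha hb => ⟨by rw [leftPart_mul]; exact add_mem ha.1 (hL _ _ hb.1),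
    by rw [rightPart_mul]; exact dvd_add ha.2 hb.2⟩
  inv_mem' := fun ha => ⟨by rw [leftPart_inv]; exact neg_mem (hL _ _ ha.1),
    by rw [rightPart_inv]; exact (dvd_neg).2 ha.2⟩

lemma isClosed_pow_dvd (k : ℕ) : IsClosed {z : ℤ_[p] | (p : ℤ_[p]) ^ k ∣ z} := by
  have h : {z : ℤ_[p] | (p : ℤ_[p]) ^ k ∣ z} =
      (Ideal.span {(p : ℤ_[p]) ^ k} : Submodule ℤ_[p] ℤ_[p]) := by
    ext z; exact Ideal.mem_span_singleton.symm
  rw [h]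
  exact isClosed_submodule _

lemma isClosed_semi (L : Submodule ℤ_[p] (Blocks p m)) (hL : ∀ z, ∀ v ∈ L, act z v ∈ L) (k : ℕ) :
    IsClosed (semi L hL k : Set (GrpG p m)) :=
  ((isClosed_submodule L).preimage continuous_leftPart).inter
    ((isClosed_pow_dvd k).preimage continuous_rightPart)

variable {L : ℕ → Submodule ℤ_[p] (Blocks p m)} {s : ℕ}

/-- The descending series of subgroups given by a filtration. -/
def semiSeries (hL : IsActFiltration L s) (i : ℕ) : Subgroup (GrpG p m) :=
  semi (L i) (hL.act_mem i) (s + i)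

lemma isClosed_semiSeries (hL : IsActFiltration L s) (i : ℕ) :
    IsClosed (semiSeries hL i : Set (GrpG p m)) := isClosed_semi _ _ _

lemma mem_semiSeries_zero (hL : IsActFiltration L s) {g : GrpG p m} :
    g ∈ semiSeries hL 0 ↔ (p : ℤ_[p]) ^ s ∣ rightPart g :=
  ⟨fun h => h.2, fun h => ⟨by rw [hL.zero]; trivial, h⟩⟩

lemma mem_semiSeries_shift_zero (g : GrpG p m) :
    g ∈ semiSeries (isActFiltration_shift (p := p) (m := m)) 0 :=
  (mem_semiSeries_zero _).2 (by simp)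

lemma pow_mem_semiSeries (hL : IsActFiltration L s) {i : ℕ} {g : GrpG p m}
    (hg : g ∈ semiSeries hL i) : g ^ p ∈ semiSeries hL (i + 1) := by
  refine ⟨?_, ?_⟩
  · rw [leftPart_pow]
    exact hL.sum_act_mem ((dvd_neg).2 ((pow_dvd_pow _ (by omega)).trans hg.2)) hg.1
  · rw [rightPart_pow, ← add_assoc, pow_succ']
    exact mul_dvd_mul_left _ hg.2

lemma commutator_mem_semiSeries (hL : IsActFiltration L s) {i : ℕ} {g h : GrpG p m}
    (hg : g ∈ semiSeries hL i) (hh : h ∈ semiSeries hL 0) : ⁅g, h⁆ ∈ semiSeries hL (i + 1) := by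
  rw [commutatorElement_eq_incl]
  refine ⟨?_, by rw [rightPart_incl]; exact dvd_zero _⟩
  rw [leftPart_incl]
  refine sub_mem ?_ (hL.act_sub_mem _ _ ((dvd_neg).2 hh.2) _ hg.1)
  have := hL.act_sub_mem_add (k := 0) ((dvd_neg).2 hg.2) hh.1
  rwa [zero_add] at this

omit [Fact p.Prime] in
lemma lowerPSeries_eq_of {Γ : Type*} [Group Γ] [TopologicalSpace Γ] [IsTopologicalGroup Γ]
    (Q : ℕ → Subgroup Γ) (h0 : Q 0 = ⊤) (hclosed : ∀ i, IsClosed (Q i : Set Γ))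
    (hpow : ∀ i, ∀ g ∈ Q i, g ^ p ∈ Q (i + 1)) (hcomm : ∀ i, ∀ g ∈ Q i, ∀ h, ⁅g, h⁆ ∈ Q (i + 1))
    (hle : ∀ i, Q (i + 1) ≤
      Subgroup.closure ((fun g : Γ => g ^ p) '' (Q i : Set Γ)) ⊔ ⁅Q i, (⊤ : Subgroup Γ)⁆) (i : ℕ) :
    lowerPSeries p Γ i = Q i := by
  induction i with
  | zero => rw [h0, lowerPSeries]
  | succ i ih =>
    rw [lowerPSeries, ih]
    refine le_antisymm (Subgroup.topologicalClosure_minimal _ (sup_le ?_ ?_) (hclosed _))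
      ((hle i).trans (Subgroup.le_topologicalClosure _))
    · rw [Subgroup.closure_le]
      rintro _ ⟨g, hg, rfl⟩
      exact hpow i g hg
    · exact Subgroup.commutator_le.2 fun g hg h _ => hcomm i g hg h

lemma inr_pow_mem (hL : IsActFiltration L s) {i : ℕ} {z : ℤ_[p]}
    (hz : (p : ℤ_[p]) ^ (s + (i + 1)) ∣ z) : ∃ g ∈ semiSeries hL i, leftPart g = 0 ∧
      g ^ p = SemidirectProduct.inr (.ofAdd z) := by
  obtain ⟨c, rfl⟩ := hz
  refine ⟨SemidirectProduct.inr (.ofAdd ((p : ℤ_[p]) ^ (s + i) * c)), ⟨zero_mem _, ?_⟩, rfl, ?_⟩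
  · exact Dvd.intro c rfl
  · rw [← map_pow, ← ofAdd_nsmul, nsmul_eq_mul]
    congr 2
    ring

variable (p m) in
lemma lowerPSeries_eq (i : ℕ) :
    lowerPSeries p (GrpG p m) i = semiSeries (isActFiltration_shift (p := p) (m := m)) i := by
  refine lowerPSeries_eq_of (semiSeries (isActFiltration_shift (p := p) (m := m))) ?_
    (isClosed_semiSeries _)
    (fun i g hg => pow_mem_semiSeries _ hg) (fun i g hg h => commutator_mem_semiSeries _ hg ?_)
    (fun i g hg => ?_) i
  · exact eq_top_iff.2 fun g _ => mem_semiSeries_shift_zero g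
  · exact mem_semiSeries_shift_zero h
  · rw [← incl_leftPart_mul_inr g]
    refine mul_mem (Subgroup.mem_sup_right ?_) (Subgroup.mem_sup_left ?_)
    · obtain ⟨v, hv⟩ := hg.1
      have h : incl (leftPart g) = ⁅incl ((shift p m ^ i) (-v)), (genY p m)⁻¹⁆ := by
        rw [commutatorElement_eq_incl, ← hv]
        congr 1
        have h1 : rightPart (genY p m)⁻¹ = -1 := rfl
        have h2 : leftPart (genY p m)⁻¹ = 0 := by rw [leftPart_inv, genY, leftPart_inr]; simp
        rw [h1, h2, neg_neg, act_one, pow_succ']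
        simp
      rw [h]
      exact Subgroup.commutator_mem_commutator ⟨⟨-v, rfl⟩, dvd_zero _⟩ trivial
    · obtain ⟨h, h1, -, h2⟩ := inr_pow_mem _ hg.2
      rw [← h2]
      exact Subgroup.subset_closure ⟨h, h1, rfl⟩

lemma semiSeries_succ_le (hL : IsActFiltration L s) (i : ℕ) :
    semiSeries hL (i + 1) ≤ semiSeries hL i :=
  fun _ hg => ⟨hL.succ_le i hg.1, (pow_dvd_pow _ (by omega)).trans hg.2⟩

instance (hL : IsActFiltration L s) (i : ℕ) : (semiSeries hL i).Normal := ⟨fun g hg h => by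
  have h1 : h * g * h⁻¹ = ⁅g, h⁆⁻¹ * g := by
    rw [commutatorElement_inv, commutatorElement_def, inv_mul_cancel_right]
  rw [h1, commutatorElement_eq_incl]
  refine mul_mem (inv_mem ⟨?_, by rw [rightPart_incl]; exact dvd_zero _⟩) hg
  rw [leftPart_incl]
  refine sub_mem ?_ (sub_mem (hL.act_mem _ _ _ hg.1) hg.1)
  have := hL.act_sub_mem_add (k := 0) ((dvd_neg).2 hg.2) (v := leftPart h)
    (by rw [hL.zero]; trivial)
  rw [zero_add] at this
  exact hL.succ_le i this⟩

instance (i : ℕ) : (lowerPSeries p (GrpG p m) i).Normal := by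
  rw [lowerPSeries_eq]
  infer_instance

/-- The additive version of the intersection with `A_1 × … × A_m`. -/
noncomputable def leftSubgroup (H : Subgroup (GrpG p m)) : AddSubgroup (Blocks p m) :=
  AddSubgroup.toSubgroup.symm (H.comap SemidirectProduct.inl)

/-- The additive version of the image in `C`. -/
noncomputable def rightSubgroup (H : Subgroup (GrpG p m)) : AddSubgroup ℤ_[p] :=
  AddSubgroup.toSubgroup.symm (H.map SemidirectProduct.rightHom)

lemma relIndex_eq_left_mul_right (K H : Subgroup (GrpG p m)) [(K.subgroupOf H).Normal] :
    K.relIndex H = (rightSubgroup (K ⊓ H)).relIndex (rightSubgroup H) *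
      (leftSubgroup K).relIndex (leftSubgroup H) := by
  rw [relIndex_eq_map_mul_ker SemidirectProduct.rightHom K H]
  congr 1
  rw [← SemidirectProduct.range_inl_eq_ker_rightHom, inf_comm, ← Subgroup.map_comap_eq,
    ← Subgroup.relIndex_comap]
  rfl

lemma leftSubgroup_semiSeries (hL : IsActFiltration L s) (i : ℕ) :
    leftSubgroup (semiSeries hL i) = (L i).toAddSubgroup := by
  ext v
  exact ⟨fun h => h.1, fun h => ⟨h, dvd_zero _⟩⟩

lemma index_semiSeries (hL : IsActFiltration L s) (i : ℕ) :
    (semiSeries hL i).index = p ^ (s + i) * (L i).toAddSubgroup.index := by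
  rw [← Subgroup.relIndex_top_right, relIndex_eq_left_mul_right, leftSubgroup_semiSeries]
  have h1 : leftSubgroup (⊤ : Subgroup (GrpG p m)) = ⊤ := rfl
  have h2 : rightSubgroup (⊤ : Subgroup (GrpG p m)) = ⊤ :=
    eq_top_iff.2 fun z _ => ⟨SemidirectProduct.inr (.ofAdd z), trivial, rfl⟩
  have h3 : rightSubgroup (semiSeries hL i ⊓ ⊤) =
      (LinearMap.range (((p : ℤ_[p]) • (1 : Module.End ℤ_[p] ℤ_[p])) ^ (s + i))).toAddSubgroup := by
    ext z
    constructor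
    · rintro ⟨g, ⟨⟨-, c, hc⟩, -⟩, rfl⟩
      refine ⟨c, ?_⟩
      change _ = rightPart g
      rw [hc]
      simp [smul_pow]
    · rintro ⟨c, rfl⟩
      refine ⟨SemidirectProduct.inr (.ofAdd ((p : ℤ_[p]) ^ (s + i) * c)),
        ⟨⟨zero_mem _, Dvd.intro c rfl⟩, trivial⟩, ?_⟩
      change (p : ℤ_[p]) ^ (s + i) * c =
        (((p : ℤ_[p]) • (1 : Module.End ℤ_[p] ℤ_[p])) ^ (s + i)) c
      simp [smul_pow]
  rw [h1, h2, h3, AddSubgroup.relIndex_top_right, AddSubgroup.relIndex_top_right,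
    index_range_pow_smul, Module.finrank_self, one_mul]

variable (p m) in
lemma index_lowerPSeries (i : ℕ) : (lowerPSeries p (GrpG p m) i).index = p ^ ((m + 1) * i) := by
  rw [lowerPSeries_eq, index_semiSeries, index_range_shift_pow, ← pow_add]
  congr 1
  ring

lemma pow_pow_mem_lowerPSeries (g : GrpG p m) (i : ℕ) :
    g ^ p ^ i ∈ lowerPSeries p (GrpG p m) i := by
  rw [lowerPSeries_eq]
  induction i with
  | zero => exact mem_semiSeries_shift_zero _
  | succ i ih => rw [pow_succ, pow_mul]; exact pow_mem_semiSeries _ ih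

lemma isClosed_leftSubgroup {H : Subgroup (GrpG p m)} (hH : IsClosed (H : Set (GrpG p m))) :
    IsClosed (leftSubgroup H : Set (Blocks p m)) := hH.preimage continuous_incl

lemma isClosed_rightSubgroup {H : Subgroup (GrpG p m)} (hH : IsClosed (H : Set (GrpG p m))) :
    IsClosed (rightSubgroup H : Set ℤ_[p]) :=
  (hH.isCompact.image continuous_rightPart).isClosed

/-- The Hausdorff dimension of a closed subgroup in terms of the ranks of its image in `C` and of
the slices of its intersection with `A_1 × … × A_m`. -/
lemma hdim_eq {H : Subgroup (GrpG p m)} (B : Submodule ℤ_[p] (Blocks p m))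
    (hB : B.toAddSubgroup = leftSubgroup H) (R : Submodule ℤ_[p] ℤ_[p])
    (hR : R.toAddSubgroup = rightSubgroup H) :
    hdim p (lowerPSeries p (GrpG p m)) H = ((Module.finrank ℤ_[p] R : ℝ) +
      ∑ j, (Module.finrank ℤ_[p] (sliceSubmodule B j) : ℝ) / blockRank j) / (m + 1) := by
  obtain ⟨C, hC⟩ := exists_logb_relIndex_slices (fun j => (blockRank_prime j).pos) B
  obtain ⟨C', hC'⟩ := exists_logb_relIndex_bound R
  set t : ℝ := (Module.finrank ℤ_[p] R : ℝ) +
      ∑ j, (Module.finrank ℤ_[p] (sliceSubmodule B j) : ℝ) / blockRank j with ht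
  have hbound (i : ℕ) : |Real.logb p ((lowerPSeries p (GrpG p m) i).relIndex
      (H ⊔ lowerPSeries p (GrpG p m) i)) - i * t| ≤ C + C' := by
    rw [Subgroup.relIndex_sup_right, relIndex_eq_left_mul_right, ← hB, ← hR]
    have h1 := hC i (leftSubgroup (lowerPSeries p (GrpG p m) i))
      (fun v hv j => by
        rw [lowerPSeries_eq, leftSubgroup_semiSeries] at hv
        exact shift_pow_div hv j)
      (fun j v hv => by
        rw [lowerPSeries_eq, leftSubgroup_semiSeries]
        exact pow_smul_mem_range_shift_of_tail i j v hv)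
    have h2 := hC' i (rightSubgroup (lowerPSeries p (GrpG p m) i ⊓ H))
      (fun z hz => by
        change z ∈ R.toAddSubgroup at hz
        rw [hR] at hz
        obtain ⟨g, hg, rfl⟩ := hz
        refine ⟨(g ^ p ^ i) ^ p, ⟨pow_mem (pow_pow_mem_lowerPSeries g i) _,
          pow_mem (pow_mem hg _) _⟩, ?_⟩
        change rightPart ((g ^ p ^ i) ^ p) = (p : ℤ_[p]) ^ (i + 1) • rightPart g
        rw [rightPart_pow, rightPart_pow, pow_succ', smul_eq_mul, mul_assoc, Nat.cast_pow])
      (fun z hz _ => by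
        obtain ⟨g, ⟨hg, -⟩, rfl⟩ := hz
        change g ∈ lowerPSeries p (GrpG p m) i at hg
        rw [lowerPSeries_eq] at hg
        obtain ⟨c, hc⟩ := hg.2
        rw [zero_add] at hc
        exact ⟨c, hc⟩)
    rw [Nat.cast_mul, Real.logb_mul (Nat.cast_ne_zero.2 h2.1.ne') (Nat.cast_ne_zero.2 h1.1.ne')]
    have h3 := abs_le.1 h1.2
    have h4 := abs_le.1 h2.2
    rw [ht, abs_le]
    constructor <;> linarith
  refine Tendsto.liminf_eq ?_
  have hp : 1 < (p : ℝ) := mod_cast (Fact.out : p.Prime).one_lt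
  have hlim : Tendsto (fun i : ℕ => (C + C') / (m + 1) / (i : ℝ)) atTop (𝓝 0) :=
    tendsto_const_nhds.div_atTop tendsto_natCast_atTop_atTop
  rw [tendsto_iff_norm_sub_tendsto_zero]
  refine squeeze_zero' (Eventually.of_forall fun _ => norm_nonneg _) ?_ hlim
  filter_upwards [eventually_gt_atTop 0] with i hi
  have hi' : (0 : ℝ) < i := mod_cast hi
  have hm : (0 : ℝ) < m + 1 := by positivity
  rw [index_lowerPSeries, Nat.cast_pow, Real.logb_pow, Real.logb_self_eq_one hp, mul_one,
    Real.norm_eq_abs]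
  push_cast
  have h := hbound i
  set x := Real.logb p ((lowerPSeries p (GrpG p m) i).relIndex
      (H ⊔ lowerPSeries p (GrpG p m) i))
  have h5 : x / ((m + 1) * i) - t / (m + 1) = (x - i * t) / (m + 1) / i := by
    field_simp
  rw [h5, abs_div, abs_div, abs_of_pos hm, abs_of_pos hi']
  gcongr

end GroupStructure

section Spectrum

variable {p : ℕ} [Fact p.Prime] {m : ℕ}

lemma hdim_prodSubgroup (B : (j : Fin m) → Submodule ℤ_[p] (Fin (blockRank j) → ℤ_[p])) :
    hdim p (lowerPSeries p (GrpG p m)) (prodSubgroup p B) =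
      (∑ j : Fin m, (Module.finrank ℤ_[p] (B j) : ℝ) / (blockRank j : ℝ)) / ((m : ℝ) + 1) := by
  rw [hdim_eq (Submodule.pi Set.univ B) ?_ ⊥ ?_]
  · have h (j : Fin m) : Module.finrank ℤ_[p] (sliceSubmodule (Submodule.pi Set.univ B) j) =
        Module.finrank ℤ_[p] (B j) :=
      congrArg (fun D : Submodule ℤ_[p] (Fin (blockRank j) → ℤ_[p]) => Module.finrank ℤ_[p] D)
        (sliceSubmodule_pi (q := fun j : Fin m => blockRank j) B j)
    simp only [h, finrank_bot]
    simp
  · ext v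
    constructor
    · intro hv
      exact ⟨.ofAdd v, hv, rfl⟩
    · rintro ⟨w, hw, h⟩
      obtain rfl : w = .ofAdd v := SemidirectProduct.inl_injective h
      exact hw
  · ext z
    constructor
    · rintro rfl
      exact zero_mem _
    · rintro ⟨_, ⟨w, hw, rfl⟩, rfl⟩
      exact rfl

lemma isClosed_prodSubgroup (B : (j : Fin m) → Submodule ℤ_[p] (Fin (blockRank j) → ℤ_[p])) :
    IsClosed (prodSubgroup p B : Set (GrpG p m)) := by
  have h : (prodSubgroup p B : Set (GrpG p m)) =
      incl '' (Submodule.pi Set.univ B : Submodule ℤ_[p] (Blocks p m)) := rfl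
  rw [h]
  exact ((isClosed_submodule (Submodule.pi Set.univ B)).isCompact.image continuous_incl).isClosed

/-- The possible values of the Hausdorff dimension. -/
noncomputable def spectrumValue (m : ℕ) (x : Fin 2 × ((j : Fin m) → Fin (blockRank j + 1))) : ℝ :=
  (((x.1 : ℕ) : ℝ) + ∑ j, ((x.2 j : ℕ) : ℝ) / blockRank j) / (m + 1)

variable (p m)

lemma hspec_subset : hspec p (GrpG p m) ⊆ Set.range (spectrumValue m) := by
  rintro _ ⟨H, hH, rfl⟩
  let B : Submodule ℤ_[p] (Blocks p m) := closedSubmodule _ (isClosed_leftSubgroup hH)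
  let R : Submodule ℤ_[p] ℤ_[p] := closedSubmodule _ (isClosed_rightSubgroup hH)
  rw [hdim_eq B rfl R rfl]
  have h1 : Module.finrank ℤ_[p] R < 2 := by
    have := R.finrank_le
    rw [Module.finrank_self] at this
    omega
  exact ⟨(⟨_, h1⟩, fun j => ⟨_, Nat.lt_succ_of_le
    (finrank_sliceSubmodule_le (q := fun j : Fin m => blockRank j) B j)⟩), rfl⟩

lemma finite_hspec : (hspec p (GrpG p m)).Finite :=
  (Set.finite_range _).subset (hspec_subset p m)

lemma ncard_hspec_le : (hspec p (GrpG p m)).ncard ≤ 2 * ∏ j : Fin m, (blockRank j + 1) := by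
  refine (Set.ncard_le_ncard (hspec_subset p m) (Set.finite_range _)).trans ?_
  rw [← Set.image_univ]
  refine (Set.ncard_image_le Set.finite_univ).trans ?_
  rw [Set.ncard_univ]
  simp

omit [Fact p.Prime] in
lemma eq_of_sum_div_eq {ι : Type*} [Fintype ι] {q : ι → ℕ} (hq : ∀ j, 0 < q j)
    (hco : Pairwise fun i j => (q i).Coprime (q j)) {d e : (j : ι) → Fin (q j)}
    (h : ∑ j, ((d j : ℕ) : ℝ) / q j = ∑ j, ((e j : ℕ) : ℝ) / q j) : d = e := by
  classical
  have hz : ∑ j, ((d j : ℤ) - e j) * ∏ i ∈ Finset.univ.erase j, (q i : ℤ) = 0 := by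
    have h1 : ∑ j, (((d j : ℕ) : ℝ) - (e j : ℕ)) / q j = 0 := by
      simp only [sub_div, Finset.sum_sub_distrib, h, sub_self]
    have h2 : (∑ j, (((d j : ℕ) : ℝ) - (e j : ℕ)) / q j) * ∏ i, (q i : ℝ) = 0 := by
      rw [h1, zero_mul]
    rw [Finset.sum_mul] at h2
    have h3 : ∑ j, (((d j : ℕ) : ℝ) - (e j : ℕ)) * ∏ i ∈ Finset.univ.erase j, (q i : ℝ) = 0 := by
      rw [← h2]
      refine Finset.sum_congr rfl fun j _ => ?_
      rw [← Finset.mul_prod_erase Finset.univ (fun i => (q i : ℝ)) (Finset.mem_univ j), ← mul_assoc,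
        div_mul_cancel₀ _ (Nat.cast_ne_zero.2 (hq j).ne')]
    exact_mod_cast h3
  funext k
  have hdvd : (q k : ℤ) ∣ ((d k : ℤ) - e k) * ∏ i ∈ Finset.univ.erase k, (q i : ℤ) := by
    rw [← Finset.add_sum_erase _ _ (Finset.mem_univ k)] at hz
    rw [eq_neg_of_add_eq_zero_left hz, dvd_neg]
    refine Finset.dvd_sum fun j hj => Dvd.dvd.mul_left (Finset.dvd_prod_of_mem _ ?_) _
    exact Finset.mem_erase.2 ⟨(Finset.ne_of_mem_erase hj).symm, Finset.mem_univ _⟩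
  have hcop : IsCoprime (q k : ℤ) (∏ i ∈ Finset.univ.erase k, (q i : ℤ)) :=
    IsCoprime.prod_right fun i hi =>
      Nat.isCoprime_iff_coprime.2 (hco (Finset.ne_of_mem_erase hi).symm)
  have h4 := Int.eq_zero_of_abs_lt_dvd (hcop.dvd_of_dvd_mul_right hdvd)
    (by rw [abs_lt]; have := (d k).2; have := (e k).2; constructor <;> omega)
  exact Fin.ext (by omega)

lemma exists_submodule_finrank_eq {d q : ℕ} (h : d ≤ q) :
    ∃ B : Submodule ℤ_[p] (Fin q → ℤ_[p]), Module.finrank ℤ_[p] B = d := by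
  refine ⟨LinearMap.range (Function.ExtendByZero.linearMap ℤ_[p] (Fin.castLE h)), ?_⟩
  rw [LinearMap.finrank_range_of_inj, Module.finrank_fin_fun]
  intro v w hvw
  funext i
  have := congrFun hvw (Fin.castLE h i)
  simpa [(Fin.castLE_injective h).extend_apply] using this

lemma prod_blockRank_le_ncard_hspec :
    ∏ j : Fin m, blockRank j ≤ (hspec p (GrpG p m)).ncard := by
  let f : ((j : Fin m) → Fin (blockRank j)) → ℝ := fun d =>
    (∑ j, ((d j : ℕ) : ℝ) / blockRank j) / ((m : ℝ) + 1)
  have hf : Function.Injective f := by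
    intro d e h
    have hm : ((m : ℝ) + 1) ≠ 0 := by positivity
    refine eq_of_sum_div_eq (q := fun j : Fin m => blockRank j)
      (fun j => (blockRank_prime j).pos) (fun i j hij => ?_) ((div_left_inj' hm).1 h)
    exact (Nat.coprime_primes (blockRank_prime i) (blockRank_prime j)).2
      fun h => hij (Fin.ext (blockRank_strictMono.injective h))
  have hsub : Set.range f ⊆ hspec p (GrpG p m) := by
    rintro _ ⟨d, rfl⟩
    choose B hB using fun j => exists_submodule_finrank_eq p (d j).2.le
    refine ⟨_, isClosed_prodSubgroup B, ?_⟩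
    rw [hdim_prodSubgroup]
    simp only [hB, f]
  refine le_trans (le_of_eq ?_) (Set.ncard_le_ncard hsub (finite_hspec p m))
  rw [← Set.image_univ, Set.ncard_image_of_injective _ hf, Set.ncard_univ]
  simp

end Spectrum

section Primes

lemma blockRank_le_mul_log (j : ℕ) :
    (blockRank j : ℝ) ≤ 6 * (j + 1) * Real.log (blockRank j) := by
  set q := blockRank j with hq
  have h2 : 2 ≤ q := (blockRank_prime j).two_le
  have h2' : (2 : ℝ) ≤ q := mod_cast h2
  have hπ : Nat.primeCounting q = j + 1 := by
    rw [Nat.primeCounting_eq_primeCounting'_succ, Nat.primeCounting', Nat.count_succ,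
      if_pos (blockRank_prime j), hq, blockRank,
      Nat.count_nth_of_infinite Nat.infinite_setOfPred_prime]
  have h1 := (Chebyshev.psi_ge q).trans (Chebyshev.psi_le_primeCounting_mul_log q)
  rw [hπ] at h1
  push_cast at h1
  have h3 : Real.log (q + 1) ≤ 2 * Real.log q := by
    rw [← Real.log_rpow (by positivity)]
    refine Real.log_le_log (by positivity) ?_
    rw [Real.rpow_two]
    nlinarith
  have h4 : 0 ≤ Real.log q := Real.log_nonneg (by linarith)
  have h5 := Real.log_two_gt_d9
  have h6 : (0 : ℝ) ≤ j * Real.log q := by positivity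
  nlinarith

lemma blockRank_le_sq (j : ℕ) : (blockRank j : ℝ) ≤ 144 * ((j : ℝ) + 1) ^ 2 := by
  have h1 := blockRank_le_mul_log j
  have hq : (0 : ℝ) < blockRank j := mod_cast (blockRank_prime j).pos
  have h2 : Real.log (blockRank j) ≤ 2 * √(blockRank j) := by
    have := Real.log_le_rpow_div hq.le (show (0 : ℝ) < 1 / 2 by norm_num)
    rw [← Real.sqrt_eq_rpow] at this
    linarith
  have h3 := Real.sq_sqrt hq.le
  have h4 := Real.sqrt_pos.2 hq
  set s := √(blockRank j : ℝ)
  have h5 : s ≤ 12 * (j + 1) := by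
    have h6 : s * s ≤ 12 * (j + 1) * s := by
      have : (0 : ℝ) ≤ 6 * (j + 1) := by positivity
      nlinarith
    exact le_of_mul_le_mul_right h6 h4
  rw [← h3]
  nlinarith

lemma two_le_log {m : ℕ} (hm : 12 ≤ m) : 2 ≤ Real.log m := by
  rw [Real.le_log_iff_exp_le (by positivity)]
  have h1 := Real.exp_one_lt_d9
  have h2 : Real.exp 2 = Real.exp 1 * Real.exp 1 := by rw [← Real.exp_add]; norm_num
  have h3 : (12 : ℝ) ≤ m := mod_cast hm
  have h4 := Real.exp_pos 1
  nlinarith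

lemma sum_blockRank_le {m : ℕ} (hm : 12 ≤ m) :
    1 + ∑ j : Fin m, (blockRank j : ℝ) ≤ 25 * (m ^ 2 * Real.log m) := by
  have hm' : (12 : ℝ) ≤ m := mod_cast hm
  have hlog := two_le_log hm
  have h (j : Fin m) : (blockRank j : ℝ) ≤ 24 * (m * Real.log m) := by
    have hj : (j : ℝ) + 1 ≤ m := mod_cast j.2
    have hq : (0 : ℝ) < blockRank j := mod_cast (blockRank_prime j).pos
    have h1 : Real.log (blockRank j) ≤ 4 * Real.log m := by
      have h4 : Real.log ((m : ℝ) ^ 4) = 4 * Real.log m := by simp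
      rw [← h4]
      refine Real.log_le_log hq ((blockRank_le_sq j).trans ?_)
      have h2 : ((j : ℝ) + 1) ^ 2 ≤ (m : ℝ) ^ 2 := by gcongr
      have h3 : (144 : ℝ) ≤ (m : ℝ) ^ 2 := by nlinarith
      nlinarith
    calc (blockRank j : ℝ) ≤ 6 * ((j : ℝ) + 1) * Real.log (blockRank j) := blockRank_le_mul_log j
      _ ≤ 6 * m * (4 * Real.log m) := by
        have : 0 ≤ Real.log (blockRank j) :=
          Real.log_nonneg (mod_cast (blockRank_prime j).one_lt.le)
        gcongr
      _ = _ := by ring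
  have h1 := Finset.sum_le_sum fun (j : Fin m) (_ : j ∈ Finset.univ) => h j
  rw [Finset.sum_const, Finset.card_univ, Fintype.card_fin, nsmul_eq_mul] at h1
  nlinarith

lemma le_log_prod_blockRank {m : ℕ} (hm : 12 ≤ m) :
    m * Real.log m / 2 ≤ Real.log (∏ j : Fin m, (blockRank j : ℝ)) := by
  have hm' : (0 : ℝ) < m := mod_cast (by omega)
  have hlog := two_le_log hm
  have h1 : (m.factorial : ℝ) ≤ ∏ j : Fin m, (blockRank j : ℝ) := by
    rw [Fin.prod_univ_eq_prod_range (fun j => (blockRank j : ℝ)),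
      ← Finset.prod_range_add_one_eq_factorial, Nat.cast_prod]
    refine Finset.prod_le_prod (fun _ _ => by positivity) fun j _ => ?_
    exact_mod_cast (Nat.le_succ _).trans (Nat.add_two_le_nth_prime j)
  have hf : (0 : ℝ) < m.factorial := mod_cast m.factorial_pos
  refine le_trans ?_ (Real.log_le_log hf h1)
  have h2 := Real.log_le_log (by positivity) (Real.pow_div_factorial_le_exp (m : ℝ) hm'.le m)
  rw [Real.log_div (by positivity) hf.ne', Real.log_pow, Real.log_exp] at h2
  nlinarith

end Primes

section Asymptotic

variable (p : ℕ) [Fact p.Prime]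

lemma log_ncard_hspec_bounds (m : ℕ) :
    Real.log (∏ j : Fin m, (blockRank j : ℝ)) ≤ Real.log ((hspec p (GrpG p m)).ncard : ℝ) ∧
    Real.log ((hspec p (GrpG p m)).ncard : ℝ) ≤
      Real.log (∏ j : Fin m, (blockRank j : ℝ)) + (m + 1) := by
  have hpos : 0 < ∏ j : Fin m, blockRank j := Finset.prod_pos fun j _ => (blockRank_prime j).pos
  have h1 := prod_blockRank_le_ncard_hspec p m
  have h2 : (hspec p (GrpG p m)).ncard ≤ 2 ^ (m + 1) * ∏ j : Fin m, blockRank j := by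
    refine (ncard_hspec_le p m).trans ?_
    have : ∏ j : Fin m, (blockRank j + 1) ≤ ∏ j : Fin m, (2 * blockRank j) :=
      Finset.prod_le_prod' fun j _ => by have := (blockRank_prime j).pos; omega
    rw [Finset.prod_mul_distrib, Finset.prod_const, Finset.card_univ, Fintype.card_fin] at this
    rw [pow_succ', mul_assoc]
    exact Nat.mul_le_mul_left _ this
  rw [← Nat.cast_prod]
  refine ⟨Real.log_le_log (mod_cast hpos) (mod_cast h1), ?_⟩
  have h3 : Real.log ((hspec p (GrpG p m)).ncard : ℝ) ≤
      Real.log ((2 : ℝ) ^ (m + 1) * ((∏ j : Fin m, blockRank j : ℕ) : ℝ)) :=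
    Real.log_le_log (mod_cast hpos.trans_le h1) (mod_cast h2)
  rw [Real.log_mul (by positivity) (mod_cast hpos.ne'), Real.log_pow] at h3
  have h4 := Real.log_two_lt_d9
  have h5 : (0 : ℝ) ≤ m := Nat.cast_nonneg m
  push_cast at h3 ⊢
  nlinarith

lemma isEquivalent_log_ncard_hspec : Asymptotics.IsEquivalent atTop
    (fun m : ℕ => Real.log ((hspec p (GrpG p m)).ncard : ℝ))
    (fun m : ℕ => Real.log (∏ j : Fin m, (blockRank j : ℝ))) := by
  refine Asymptotics.isLittleO_iff.2 fun c hc => ?_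
  have hlog : Tendsto (fun m : ℕ => Real.log m) atTop atTop :=
    Real.tendsto_log_atTop.comp tendsto_natCast_atTop_atTop
  filter_upwards [hlog.eventually_ge_atTop (4 / c), eventually_ge_atTop 12] with m hm1 hm
  obtain ⟨h1, h2⟩ := log_ncard_hspec_bounds p m
  have h3 := le_log_prod_blockRank hm
  have hm' : (12 : ℝ) ≤ m := mod_cast hm
  have h4 := two_le_log hm
  rw [Pi.sub_apply, Real.norm_eq_abs, Real.norm_eq_abs, abs_of_nonneg (by linarith),
    abs_of_nonneg (by nlinarith)]
  rw [div_le_iff₀ hc] at hm1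
  have h5 : (m : ℝ) * 4 ≤ m * (Real.log m * c) := by gcongr
  have h6 := mul_le_mul_of_nonneg_left h3 hc.le
  linarith

lemma tendsto_logb_ncard_hspec {D : ℕ → ℕ}
    (hD : ∀ m, 1 ≤ m → D m = 1 + ∑ j : Fin m, blockRank j) :
    Tendsto (fun m : ℕ => Real.logb p ((hspec p (GrpG p m)).ncard : ℝ) / √(D m : ℝ))
      atTop atTop := by
  have hlog : Tendsto (fun m : ℕ => Real.log m) atTop atTop :=
    Real.tendsto_log_atTop.comp tendsto_natCast_atTop_atTop
  have hp : 0 < Real.log p := Real.log_pos (mod_cast (Fact.out : p.Prime).one_lt)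
  have hlim : Tendsto (fun m : ℕ => √(Real.log m) / (10 * Real.log p)) atTop atTop :=
    (Real.tendsto_sqrt_atTop.comp hlog).atTop_div_const (by positivity)
  refine tendsto_atTop_mono' _ ?_ hlim
  filter_upwards [eventually_ge_atTop 12] with m hm
  have hm' : (0 : ℝ) < m := mod_cast (by omega)
  have h4 := two_le_log hm
  have h1 := (le_log_prod_blockRank hm).trans (log_ncard_hspec_bounds p m).1
  have h2 : √(D m : ℝ) ≤ 5 * (m * √(Real.log m)) := by
    rw [hD m (by omega)]
    refine Real.sqrt_le_iff.2 ⟨by positivity, ?_⟩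
    rw [mul_pow, mul_pow, Real.sq_sqrt (by linarith)]
    have := sum_blockRank_le hm
    push_cast
    linarith
  have h3 : 0 < √(D m : ℝ) := by
    rw [hD m (by omega)]
    positivity
  have hs := Real.sq_sqrt (show 0 ≤ Real.log m by linarith)
  rw [le_div_iff₀ h3, Real.logb]
  calc √(Real.log m) / (10 * Real.log p) * √(D m : ℝ)
      ≤ √(Real.log m) / (10 * Real.log p) * (5 * (m * √(Real.log m))) := by gcongr
    _ = (m * (√(Real.log m)) ^ 2 / 2) / Real.log p := by field_simp; ring
    _ = (m * Real.log m / 2) / Real.log p := by rw [hs]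
    _ ≤ _ := by gcongr

end Asymptotic

section ProP

variable {p : ℕ} [Fact p.Prime] {m : ℕ}

lemma eq_zero_of_forall_pow_dvd {z : ℤ_[p]} (h : ∀ n : ℕ, (p : ℤ_[p]) ^ n ∣ z) : z = 0 := by
  by_contra hz
  obtain ⟨n, hn⟩ := FiniteMultiplicity.of_not_isUnit PadicInt.prime_p.not_isUnit hz
  exact hn (h (n + 1))

lemma lowerPSeries_antitone : Antitone (lowerPSeries p (GrpG p m)) :=
  antitone_nat_of_succ_le fun i => by
    rw [lowerPSeries_eq, lowerPSeries_eq]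
    exact semiSeries_succ_le _ i

lemma exists_lowerPSeries_le {V : Subgroup (GrpG p m)} (hV : IsOpen (V : Set (GrpG p m))) :
    ∃ i, lowerPSeries p (GrpG p m) i ≤ V := by
  refine exists_subset_nhds_of_compactSpace
    (V := fun i => (lowerPSeries p (GrpG p m) i : Set (GrpG p m)))
    (directed_of_isDirected_le fun i j hij => lowerPSeries_antitone hij)
    (fun i => by rw [lowerPSeries_eq]; exact isClosed_semiSeries _ i) fun g hg => ?_
  have hg' (i : ℕ) : g ∈ semiSeries (isActFiltration_shift (p := p) (m := m)) i := by
    rw [← lowerPSeries_eq]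
    exact Set.mem_iInter.1 hg i
  have h1 : rightPart g = 0 := eq_zero_of_forall_pow_dvd fun n => by
    have := (hg' n).2
    rwa [zero_add] at this
  have h2 : leftPart g = 0 := funext fun j => funext fun k => eq_zero_of_forall_pow_dvd fun n => by
    obtain ⟨w, hw⟩ := shift_pow_div (hg' (n * blockRank j)).1 j
    rw [Nat.mul_div_cancel _ (blockRank_prime j).pos] at hw
    rw [hw]
    exact Dvd.intro (w k) rfl
  obtain rfl : g = 1 := grp_ext h2 h1
  exact hV.mem_nhds V.one_mem

lemma exists_index_eq_pow {V : Subgroup (GrpG p m)} (hV : IsOpen (V : Set (GrpG p m))) :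
    ∃ k, V.index = p ^ k := by
  obtain ⟨i, hi⟩ := exists_lowerPSeries_le hV
  have h := Subgroup.index_dvd_of_le hi
  rw [index_lowerPSeries] at h
  obtain ⟨k, -, hk⟩ := (Nat.dvd_prime_pow (Fact.out : p.Prime)).1 h
  exact ⟨k, hk⟩

variable (p m) in
lemma isProP_grpG : IsProP p (GrpG p m) where
  compactSpace := inferInstance
  t2Space := inferInstance
  totallyDisconnectedSpace := inferInstance
  index_eq_pow _ _ hU := exists_index_eq_pow hU

lemma isProP_of_isOpen {U : Subgroup (GrpG p m)} (hU : IsOpen (U : Set (GrpG p m))) :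
    IsProP p U where
  compactSpace := isCompact_iff_compactSpace.1 (U.isClosed_of_isOpen hU).isCompact
  t2Space := inferInstance
  totallyDisconnectedSpace := inferInstance
  index_eq_pow V _ hV := by
    have h1 : IsOpen (V.map U.subtype : Set (GrpG p m)) := hU.isOpenMap_subtype_val _ hV
    obtain ⟨k, hk⟩ := exists_index_eq_pow h1
    rw [Subgroup.index_map_subtype] at hk
    obtain ⟨l, -, hl⟩ := (Nat.dvd_prime_pow (Fact.out : p.Prime)).1 (Dvd.intro _ hk)
    exact ⟨l, hl⟩

end ProP

section Uniform

variable {p : ℕ} [Fact p.Prime] {m : ℕ}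

variable (p m) in
/-- The filtration `p ^ k A` of the product of the blocks. -/
noncomputable def powFiltration (k : ℕ) : Submodule ℤ_[p] (Blocks p m) :=
  LinearMap.range (((p : ℤ_[p]) • (1 : Module.End ℤ_[p] (Blocks p m))) ^ k)

lemma mem_powFiltration {k : ℕ} {v : Blocks p m} :
    v ∈ powFiltration p m k ↔ ∃ w, v = (p : ℤ_[p]) ^ k • w := by
  simp [powFiltration, smul_pow, eq_comm]

lemma act_sub_mem_powFiltration_two {z : ℤ_[p]} (hz : (p : ℤ_[p]) ^ (2 * blockRank m) ∣ z)
    (v : Blocks p m) : act z v - v ∈ powFiltration p m 2 := by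
  have h := (isActFiltration_shift (p := p) (m := m)).act_sub_mem_add (k := 0) (v := v)
    (i := 2 * blockRank m) (z := z) (by rwa [zero_add])
    (by rw [isActFiltration_shift.zero]; trivial)
  have h2 (j : Fin m) : ∃ w, (act z v - v) j = (p : ℤ_[p]) ^ 2 • w := by
    obtain ⟨w, hw⟩ := shift_pow_div h j
    have hle : 2 ≤ (0 + 2 * blockRank m + 1) / blockRank j := by
      rw [Nat.le_div_iff_mul_le (blockRank_prime j).pos]
      have := blockRank_strictMono.monotone j.2.le
      omega
    obtain ⟨c, hc⟩ := Nat.exists_eq_add_of_le hle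
    refine ⟨(p : ℤ_[p]) ^ c • w, ?_⟩
    rw [hw, hc, pow_add, mul_smul]
  choose w hw using h2
  exact mem_powFiltration.2 ⟨w, funext hw⟩

variable (p m) in
lemma isActFiltration_pow : IsActFiltration (powFiltration p m) (2 * blockRank m) where
  zero := by simp [powFiltration, Module.End.one_eq_id]
  succ_le k v hv := by
    obtain ⟨w, rfl⟩ := mem_powFiltration.1 hv
    exact mem_powFiltration.2 ⟨(p : ℤ_[p]) • w, by rw [smul_smul, pow_succ]⟩
  smul_mem k v hv := by
    obtain ⟨w, rfl⟩ := mem_powFiltration.1 hv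
    exact mem_powFiltration.2 ⟨w, by rw [smul_smul, pow_succ']⟩
  act_sub_mem k z hz v hv := by
    obtain ⟨w, rfl⟩ := mem_powFiltration.1 hv
    obtain ⟨u, hu⟩ := mem_powFiltration.1 (act_sub_mem_powFiltration_two hz w)
    refine mem_powFiltration.2 ⟨(p : ℤ_[p]) • u, ?_⟩
    rw [map_smul, ← smul_sub, hu, smul_smul, smul_smul]
    ring_nf
  act_mem k z v hv := by
    obtain ⟨w, rfl⟩ := mem_powFiltration.1 hv
    exact mem_powFiltration.2 ⟨act z w, map_smul _ _ _⟩

lemma finrank_blocks : Module.finrank ℤ_[p] (Blocks p m) = ∑ j : Fin m, blockRank j := by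
  simp [Module.finrank_pi_fintype]

variable (p m) in
/-- A uniform open subgroup of `G_m`. -/
noncomputable def uniformSubgroup : Subgroup (GrpG p m) :=
  semiSeries (isActFiltration_pow p m) 0

lemma mem_uniformSubgroup {g : GrpG p m} :
    g ∈ uniformSubgroup p m ↔ (p : ℤ_[p]) ^ (2 * blockRank m) ∣ rightPart g :=
  mem_semiSeries_zero _

lemma index_semiSeries_pow (i : ℕ) : (semiSeries (isActFiltration_pow p m) i).index =
    p ^ (2 * blockRank m + (1 + ∑ j : Fin m, blockRank j) * i) := by
  rw [index_semiSeries, powFiltration, index_range_pow_smul, finrank_blocks, ← pow_add]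
  ring_nf

lemma isOpen_uniformSubgroup : IsOpen (uniformSubgroup p m : Set (GrpG p m)) := by
  have : (uniformSubgroup p m).FiniteIndex := ⟨by
    rw [uniformSubgroup, index_semiSeries_pow]
    exact (pow_pos (Fact.out : p.Prime).pos _).ne'⟩
  exact Subgroup.isOpen_of_isClosed_of_finiteIndex _ (isClosed_semiSeries _ _)

lemma semiSeries_antitone {L : ℕ → Submodule ℤ_[p] (Blocks p m)} {s : ℕ}
    (hL : IsActFiltration L s) : Antitone (semiSeries hL) :=
  antitone_nat_of_succ_le (semiSeries_succ_le hL)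

lemma incl_mem_uniformSubgroup (v : Blocks p m) : incl v ∈ uniformSubgroup p m :=
  mem_uniformSubgroup.2 (dvd_zero _)

lemma lowerPSeries_uniformSubgroup (i : ℕ) : lowerPSeries p (uniformSubgroup p m) i =
    (semiSeries (isActFiltration_pow p m) i).subgroupOf (uniformSubgroup p m) := by
  refine lowerPSeries_eq_of (fun i =>
    (semiSeries (isActFiltration_pow p m) i).subgroupOf (uniformSubgroup p m))
    (Subgroup.subgroupOf_self _)
    (fun i => (isClosed_semiSeries (isActFiltration_pow p m) i).preimage continuous_subtype_val)
    (fun i g hg => pow_mem_semiSeries (isActFiltration_pow p m) hg)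
    (fun i g hg h => commutator_mem_semiSeries (isActFiltration_pow p m) hg h.2)
    (fun i g hg => ?_) i
  refine Subgroup.mem_sup_left ?_
  obtain ⟨w, hw⟩ := mem_powFiltration.1 hg.1
  obtain ⟨h, h1, -, h2⟩ := inr_pow_mem _ hg.2
  have h0 := semiSeries_antitone (isActFiltration_pow p m) (Nat.zero_le i)
  let a : uniformSubgroup p m := ⟨incl ((p : ℤ_[p]) ^ i • w), incl_mem_uniformSubgroup _⟩
  let b : uniformSubgroup p m := ⟨h, h0 h1⟩
  have hab : g = a ^ p * b ^ p := by
    refine Subtype.ext ?_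
    change (g : GrpG p m) = incl ((p : ℤ_[p]) ^ i • w) ^ p * h ^ p
    rw [h2, ← incl_nsmul, ← Nat.cast_smul_eq_nsmul ℤ_[p], smul_smul, ← pow_succ', ← hw]
    exact (incl_leftPart_mul_inr _).symm
  rw [hab]
  exact mul_mem
    (Subgroup.subset_closure ⟨a, ⟨mem_powFiltration.2 ⟨w, rfl⟩, dvd_zero _⟩, rfl⟩)
    (Subgroup.subset_closure ⟨b, h1, rfl⟩)

lemma relIndex_semiSeries_pow (i : ℕ) : (semiSeries (isActFiltration_pow p m) (i + 1)).relIndex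
    (semiSeries (isActFiltration_pow p m) i) = p ^ (1 + ∑ j : Fin m, blockRank j) := by
  have h := Subgroup.relIndex_mul_index (semiSeries_succ_le (isActFiltration_pow p m) i)
  rw [index_semiSeries_pow, index_semiSeries_pow] at h
  refine Nat.eq_of_mul_eq_mul_right (pow_pos (Fact.out : p.Prime).pos _) (h.trans ?_)
  rw [← pow_add]
  ring_nf

lemma relIndex_lowerPSeries_uniformSubgroup (i : ℕ) :
    (lowerPSeries p (uniformSubgroup p m) (i + 1)).relIndex
      (lowerPSeries p (uniformSubgroup p m) i) = p ^ (1 + ∑ j : Fin m, blockRank j) := by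
  rw [lowerPSeries_uniformSubgroup, lowerPSeries_uniformSubgroup, Subgroup.relIndex_subgroupOf,
    relIndex_semiSeries_pow]
  exact semiSeries_antitone _ (Nat.zero_le i)

lemma isPowerful_uniformSubgroup : IsPowerful p (uniformSubgroup p m) := by
  refine le_trans ?_ (Subgroup.le_topologicalClosure _)
  refine Subgroup.commutator_le.2 fun g _ h _ => Subgroup.subset_closure ?_
  obtain ⟨v, hv⟩ := mem_powFiltration.1 (act_sub_mem_powFiltration_two (m := m)
    ((dvd_neg).2 (mem_uniformSubgroup.1 g.2)) (leftPart (h : GrpG p m)))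
  obtain ⟨w, hw⟩ := mem_powFiltration.1 (act_sub_mem_powFiltration_two (m := m)
    ((dvd_neg).2 (mem_uniformSubgroup.1 h.2)) (leftPart (g : GrpG p m)))
  have key : ∀ u : Blocks p m, ∃ u', (p : ℤ_[p]) ^ 2 • u = (if p = 2 then 4 else p) • u' := by
    intro u
    split_ifs with hp
    · refine ⟨u, ?_⟩
      rw [← Nat.cast_smul_eq_nsmul ℤ_[p]]
      congr 1
      have h4 : p ^ 2 = 4 := by rw [hp]; norm_num
      exact_mod_cast h4
    · refine ⟨(p : ℤ_[p]) • u, ?_⟩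
      rw [← Nat.cast_smul_eq_nsmul ℤ_[p], smul_smul, sq]
  obtain ⟨u, hu⟩ := key (v - w)
  refine ⟨⟨incl u, incl_mem_uniformSubgroup u⟩, Subtype.ext ?_⟩
  change incl u ^ (if p = 2 then 4 else p) = ⁅(g : GrpG p m), (h : GrpG p m)⁆
  rw [commutatorElement_eq_incl, hv, hw, ← smul_sub, hu, incl_nsmul]

variable (p m) in
lemma exists_generators_uniformSubgroup : ∃ S : Finset (uniformSubgroup p m),
    S.card ≤ 1 + ∑ j : Fin m, blockRank j ∧
      (Subgroup.closure (S : Set (uniformSubgroup p m))).topologicalClosure = ⊤ := by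
  classical
  let x : Option ((j : Fin m) × Fin (blockRank j)) → uniformSubgroup p m := fun a => a.elim
    ⟨SemidirectProduct.inr (.ofAdd ((p : ℤ_[p]) ^ (2 * blockRank m))),
      mem_uniformSubgroup.2 dvd_rfl⟩
    fun b => ⟨genX p b.1 b.2, incl_mem_uniformSubgroup _⟩
  refine ⟨Finset.univ.image x, Finset.card_image_le.trans ?_, ?_⟩
  · simp [add_comm]
  set T := (Subgroup.closure ((Finset.univ.image x : Finset (uniformSubgroup p m)) :
    Set (uniformSubgroup p m))).topologicalClosure with hT
  have hTc : IsClosed (T : Set (uniformSubgroup p m)) := Subgroup.isClosed_topologicalClosure _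
  have hx (a) : x a ∈ T := Subgroup.le_topologicalClosure _ (Subgroup.subset_closure (by simp))
  let D : AddSubgroup (Blocks p m) := leftSubgroup (T.map (uniformSubgroup p m).subtype)
  have hTc' : IsClosed (T.map (uniformSubgroup p m).subtype : Set (GrpG p m)) :=
    (isClosed_semiSeries (isActFiltration_pow p m) 0).isClosedMap_subtype_val _ hTc
  let D' : Submodule ℤ_[p] (Blocks p m) := closedSubmodule D (isClosed_leftSubgroup hTc')
  have hD : D' = ⊤ := by
    rw [eq_top_iff, ← (Pi.basis fun j : Fin m => Pi.basisFun ℤ_[p] (Fin (blockRank j))).span_eq,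
      Submodule.span_le]
    rintro _ ⟨⟨j, k⟩, rfl⟩
    rw [Pi.basis_apply, Pi.basisFun_apply]
    exact ⟨_, hx (some ⟨j, k⟩), rfl⟩
  have hR (c : ℤ_[p]) : SemidirectProduct.inr (.ofAdd (c * (p : ℤ_[p]) ^ (2 * blockRank m))) ∈
      T.map (uniformSubgroup p m).subtype := by
    have hcont : Continuous fun c : ℤ_[p] => (SemidirectProduct.inr
        (.ofAdd (c * (p : ℤ_[p]) ^ (2 * blockRank m))) : GrpG p m) :=
      continuous_grpG_mk continuous_const
        (continuous_ofAdd.comp (continuous_id.mul continuous_const))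
    refine (hTc'.preimage hcont).closure_subset_iff.2 ?_ (PadicInt.denseRange_natCast c)
    rintro _ ⟨n, rfl⟩
    refine ⟨x none ^ n, pow_mem (hx none) n, ?_⟩
    change (SemidirectProduct.inr (.ofAdd ((p : ℤ_[p]) ^ (2 * blockRank m))) : GrpG p m) ^ n = _
    rw [← map_pow, ← ofAdd_nsmul, nsmul_eq_mul]
  refine eq_top_iff.2 fun g _ => ?_
  have hg : (g : GrpG p m) ∈ T.map (uniformSubgroup p m).subtype := by
    rw [← incl_leftPart_mul_inr (g : GrpG p m)]
    obtain ⟨c, hc⟩ := mem_uniformSubgroup.1 g.2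
    refine mul_mem ?_ ?_
    · have : leftPart (g : GrpG p m) ∈ D' := by rw [hD]; trivial
      exact this
    · rw [hc, mul_comm]
      exact hR c
  obtain ⟨g', hg', h⟩ := hg
  rwa [← Subtype.ext h]

variable (p m) in
lemma isUniform_uniformSubgroup : IsUniform p (uniformSubgroup p m) where
  isProP := isProP_of_isOpen isOpen_uniformSubgroup
  finitelyGenerated :=
    let ⟨S, _, hS⟩ := exists_generators_uniformSubgroup p m
    ⟨S.card, S, rfl, hS⟩
  isPowerful := isPowerful_uniformSubgroup
  relIndex_eq i := by
    have h := relIndex_lowerPSeries_uniformSubgroup (p := p) (m := m) 0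
    rw [relIndex_lowerPSeries_uniformSubgroup, ← h, lowerPSeries, Subgroup.relIndex_top_right]

end Uniform

section PowerMaps

lemma mul_pow_of_central_commutators {Q : Type*} [Group Q]
    (hc : ∀ a b k : Q, Commute ⁅a, b⁆ k) (a b : Q) (n : ℕ) :
    (a * b) ^ n = a ^ n * b ^ n * ⁅b, a⁆ ^ n.choose 2 := by
  have hcomm (n : ℕ) : b ^ n * a = a * b ^ n * ⁅b, a⁆ ^ n := by
    induction n with
    | zero => simp
    | succ n ih =>
      have h1 : b * a = a * b * ⁅b, a⁆ := by
        rw [← (hc b a (a * b)).eq, commutatorElement_def]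
        group
      calc b ^ (n + 1) * a = b ^ n * (b * a) := by rw [pow_succ, mul_assoc]
        _ = b ^ n * a * b * ⁅b, a⁆ := by rw [h1]; simp only [mul_assoc]
        _ = a * b ^ n * (⁅b, a⁆ ^ n * b) * ⁅b, a⁆ := by rw [ih]; simp only [mul_assoc]
        _ = a * b ^ (n + 1) * ⁅b, a⁆ ^ (n + 1) := by
          rw [((hc b a b).pow_left n).eq, pow_succ, pow_succ]; simp only [mul_assoc]
  induction n with
  | zero => simp
  | succ n ih =>
    calc (a * b) ^ (n + 1) = a ^ n * b ^ n * (⁅b, a⁆ ^ n.choose 2 * (a * b)) := by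
          rw [pow_succ, ih]; simp only [mul_assoc]
      _ = a ^ n * (b ^ n * a) * b * ⁅b, a⁆ ^ n.choose 2 := by
          rw [((hc b a (a * b)).pow_left _).eq]; simp only [mul_assoc]
      _ = a ^ n * a * b ^ n * (⁅b, a⁆ ^ n * b) * ⁅b, a⁆ ^ n.choose 2 := by
          rw [hcomm]; simp only [mul_assoc]
      _ = a ^ (n + 1) * b ^ (n + 1) * (⁅b, a⁆ ^ n * ⁅b, a⁆ ^ n.choose 2) := by
          rw [((hc b a b).pow_left n).eq, pow_succ, pow_succ]; simp only [mul_assoc]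
      _ = _ := by rw [← pow_add, Nat.choose_succ_succ' n 1, Nat.choose_one_right]

/-- If the commutators are central modulo `X` and their `n choose 2`-th powers lie in `X`, then
the `n`-th powers form a closed subgroup modulo `X`. -/
lemma exists_subgroup_pow {Γ : Type*} [Group Γ] [TopologicalSpace Γ] [IsTopologicalGroup Γ]
    [CompactSpace Γ] (X : Subgroup Γ) [X.Normal] (hX : IsClosed (X : Set Γ)) (n : ℕ)
    (h1 : ∀ a b k : Γ, ⁅⁅a, b⁆, k⁆ ∈ X) (h2 : ∀ a b : Γ, ⁅a, b⁆ ^ n.choose 2 ∈ X) :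
    ∃ K : Subgroup Γ, K.Normal ∧ IsClosed (K : Set Γ) ∧ ∀ g, g ∈ K ↔ ∃ h, (h ^ n)⁻¹ * g ∈ X := by
  have hmap (a b : Γ) : ⁅(a : Γ ⧸ X), (b : Γ ⧸ X)⁆ = ((⁅a, b⁆ : Γ) : Γ ⧸ X) := rfl
  have hc : ∀ a b k : Γ ⧸ X, Commute ⁅a, b⁆ k := by
    intro a b k
    induction a using QuotientGroup.induction_on with | _ a
    induction b using QuotientGroup.induction_on with | _ b
    induction k using QuotientGroup.induction_on with | _ k
    rw [← commutatorElement_eq_one_iff_commute, hmap, hmap, QuotientGroup.eq_one_iff]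
    exact h1 a b k
  have hp : ∀ a b : Γ ⧸ X, (a * b) ^ n = a ^ n * b ^ n := by
    intro a b
    induction a using QuotientGroup.induction_on with | _ a
    induction b using QuotientGroup.induction_on with | _ b
    have h3 : ((⁅b, a⁆ ^ n.choose 2 : Γ) : Γ ⧸ X) = 1 := (QuotientGroup.eq_one_iff _).2 (h2 b a)
    rw [QuotientGroup.mk_pow] at h3
    rw [mul_pow_of_central_commutators hc, hmap, h3, mul_one]
  let φ : (Γ ⧸ X) →* (Γ ⧸ X) :=
    { toFun := fun a => a ^ n, map_one' := one_pow n, map_mul' := hp }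
  have hφ : φ.range.Normal := ⟨by
    rintro _ ⟨a, rfl⟩ b
    exact ⟨b * a * b⁻¹, (conj_pow : (b * a * b⁻¹) ^ n = b * a ^ n * b⁻¹)⟩⟩
  refine ⟨φ.range.comap (QuotientGroup.mk' X), inferInstance, ?_, fun g => ?_⟩
  · have : IsClosed (φ.range : Set (Γ ⧸ X)) := by
      have : IsClosed (X : Set Γ) := hX
      have h3 : (φ.range : Set (Γ ⧸ X)) = Set.range fun a : Γ ⧸ X => a ^ n := rfl
      rw [h3]
      exact (isCompact_range (continuous_pow n)).isClosed
    exact this.preimage QuotientGroup.continuous_mk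
  · constructor
    · rintro ⟨a, ha⟩
      induction a using QuotientGroup.induction_on with | _ a
      exact ⟨a, QuotientGroup.eq.1 ha⟩
    · rintro ⟨h, hh⟩
      exact ⟨h, QuotientGroup.eq.2 hh⟩

/-- The index of a closed normal subgroup with an elementary abelian quotient bounds the number of
topological generators. -/
lemma index_dvd_of_topological_generators {Γ : Type*} [Group Γ] [TopologicalSpace Γ]
    [IsTopologicalGroup Γ] {n : ℕ} (K : Subgroup Γ) [K.Normal] [K.FiniteIndex]
    (hK : IsClosed (K : Set Γ)) (hcomm : ∀ a b : Γ, ⁅a, b⁆ ∈ K) (hpow : ∀ a : Γ, a ^ n ∈ K)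
    {S : Finset Γ} (hS : (Subgroup.closure (S : Set Γ)).topologicalClosure = ⊤) :
    K.index ∣ n ^ S.card := by
  classical
  have hopen : IsOpen (K : Set Γ) := K.isOpen_of_isClosed_of_finiteIndex hK
  have h1 : Subgroup.closure (S : Set Γ) ⊔ K = ⊤ := by
    rw [eq_top_iff, ← hS]
    exact Subgroup.topologicalClosure_minimal _ le_sup_left
      (Subgroup.isClosed_of_isOpen _ (Subgroup.isOpen_mono le_sup_right hopen))
  let inst : CommGroup (Γ ⧸ K) :=
    { (inferInstance : Group (Γ ⧸ K)) with
      mul_comm := by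
        intro a b
        induction a using QuotientGroup.induction_on with | _ a
        induction b using QuotientGroup.induction_on with | _ b
        refine QuotientGroup.eq.2 ?_
        have := hcomm b⁻¹ a⁻¹
        rw [commutatorElement_def, inv_inv, inv_inv] at this
        simpa [mul_assoc] using this }
  have h2 : Subgroup.closure ((S.image (QuotientGroup.mk' K) : Finset (Γ ⧸ K)) :
      Set (Γ ⧸ K)) = ⊤ := by
    rw [Finset.coe_image, ← MonoidHom.map_closure, ← Subgroup.map_top_of_surjective _
      (QuotientGroup.mk'_surjective K), ← h1, Subgroup.map_sup]
    simp
  have hfg : Group.FG (Γ ⧸ K) := ⟨⟨_, h2⟩⟩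
  have h3 : ∀ a : Γ ⧸ K, a ^ n = 1 := by
    intro a
    induction a using QuotientGroup.induction_on with | _ a
    exact (QuotientGroup.eq_one_iff _).2 (hpow a)
  exact (card_dvd_exponent_pow_rank' (Γ ⧸ K) h3).trans
    (pow_dvd_pow _ ((Group.rank_le h2).trans Finset.card_image_le))

end PowerMaps

section PowerfulSubgroups

variable {p : ℕ} [Fact p.Prime] {m : ℕ} {U : Subgroup (GrpG p m)}

/-- The subgroup of `A_1 × … × A_m` given by a submodule. -/
def inclSubgroup (F : Submodule ℤ_[p] (Blocks p m)) : Subgroup (GrpG p m) where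
  carrier := {g | leftPart g ∈ F ∧ rightPart g = 0}
  one_mem' := ⟨F.zero_mem, rfl⟩
  mul_mem' := fun {a b} ha hb => ⟨by
      rw [leftPart_mul, ha.2, neg_zero, act_zero]; exact add_mem ha.1 hb.1,
    by rw [rightPart_mul, ha.2, hb.2, add_zero]⟩
  inv_mem' := fun {a} ha => ⟨by
      rw [leftPart_inv, ha.2, act_zero]; exact neg_mem ha.1, by rw [rightPart_inv, ha.2, neg_zero]⟩

lemma isClosed_inclSubgroup (F : Submodule ℤ_[p] (Blocks p m)) :
    IsClosed (inclSubgroup F : Set (GrpG p m)) :=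
  ((isClosed_submodule F).preimage continuous_leftPart).inter
    (isClosed_singleton.preimage continuous_rightPart)

lemma incl_mem_inclSubgroup {F : Submodule ℤ_[p] (Blocks p m)} {v : Blocks p m} :
    incl v ∈ inclSubgroup F ↔ v ∈ F := ⟨fun h => h.1, fun h => ⟨h, rfl⟩⟩

lemma normal_inclSubgroup_subgroupOf {F : Submodule ℤ_[p] (Blocks p m)}
    (hF : ∀ g ∈ U, ∀ v ∈ F, act (rightPart g) v ∈ F) : ((inclSubgroup F).subgroupOf U).Normal :=
  ⟨fun g hg h => by
    have hg : (g : GrpG p m) ∈ inclSubgroup F := hg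
    change (h : GrpG p m) * g * (h : GrpG p m)⁻¹ ∈ inclSubgroup F
    rw [eq_incl_of_rightPart hg.2, conj_incl, incl_mem_inclSubgroup, ← rightPart_inv]
    exact hF _ (inv_mem h.2) _ hg.1⟩

lemma commutator_incl (x : Blocks p m) (g : GrpG p m) :
    ⁅incl x, g⁆ = incl (x - act (-rightPart g) x) := by
  rw [commutatorElement_eq_incl, rightPart_incl, leftPart_incl, neg_zero, act_zero]
  congr 1
  simp

/-- In an open powerful subgroup `U` the commutators are `p`-th multiples of elements of
`U ∩ (A_1 × … × A_m)`. -/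
lemma commutator_mem_smul_of_isPowerful (hU : IsOpen (U : Set (GrpG p m))) (hpow : IsPowerful p U)
    {V : Submodule ℤ_[p] (Blocks p m)} (hV : ∀ v, v ∈ V ↔ incl v ∈ U) (g h : U) :
    ⁅(g : GrpG p m), (h : GrpG p m)⁆ ∈
      inclSubgroup (V.map ((p : ℤ_[p]) • (1 : Module.End ℤ_[p] (Blocks p m)))) := by
  have hUc : CompactSpace U := isCompact_iff_compactSpace.1 (U.isClosed_of_isOpen hU).isCompact
  have hp0 : (p : ℤ_[p]) ≠ 0 := mod_cast (Fact.out : p.Prime).ne_zero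
  set pV := V.map ((p : ℤ_[p]) • (1 : Module.End ℤ_[p] (Blocks p m))) with hpV
  have mem_pV {v : Blocks p m} (hv : v ∈ V) : (p : ℤ_[p]) • v ∈ pV := ⟨v, hv, rfl⟩
  have smul_mem_pV {n : ℕ} (hn : p ∣ n) {v : Blocks p m} (hv : v ∈ V) : n • v ∈ pV := by
    obtain ⟨k, rfl⟩ := hn
    rw [mul_nsmul', ← Nat.cast_smul_eq_nsmul ℤ_[p]]
    exact mem_pV (V.nsmul_mem hv k)
  have pV_le : pV ≤ V := by
    rintro _ ⟨v, hv, rfl⟩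
    exact V.smul_mem _ hv
  have actV {g : GrpG p m} (hg : g ∈ U) {v : Blocks p m} (hv : v ∈ V) :
      act (rightPart g) v ∈ V := by
    have := mul_mem (mul_mem (inv_mem hg) ((hV v).1 hv)) (inv_mem (inv_mem hg))
    rwa [conj_incl, rightPart_inv, neg_neg, ← hV] at this
  let N : ℕ → Submodule ℤ_[p] (Blocks p m) := fun n => LinearMap.range (shift p m ^ n)
  let F : ℕ → Submodule ℤ_[p] (Blocks p m) := fun n => pV ⊔ (V ⊓ N n)
  have F_le (n : ℕ) : F n ≤ V := sup_le pV_le inf_le_left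
  have actF_sub {g : GrpG p m} (hg : g ∈ U) {n : ℕ} {v : Blocks p m} (hv : v ∈ F n) :
      v - act (rightPart g) v ∈ F (n + 1) := by
    obtain ⟨_, ⟨a, ha, rfl⟩, b, hb, rfl⟩ := Submodule.mem_sup.1 hv
    have h1 : (p : ℤ_[p]) • a + b - act (rightPart g) ((p : ℤ_[p]) • a + b) =
        (p : ℤ_[p]) • (a - act (rightPart g) a) + (b - act (rightPart g) b) := by
      rw [map_add, map_smul, smul_sub]
      abel
    refine (congrArg (· ∈ F (n + 1)) h1).mpr (Submodule.add_mem_sup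
      (mem_pV (sub_mem ha (actV hg ha))) ⟨sub_mem hb.1 (actV hg hb.1), ?_⟩)
    rw [← neg_sub]
    exact neg_mem (act_sub_mem_range_shift n _ b hb.2)
  have F_anti (n : ℕ) : F (n + 1) ≤ F n :=
    sup_le_sup_left (inf_le_inf_left _ (range_shift_pow_antitone n.le_succ)) _
  have actF {g : GrpG p m} (hg : g ∈ U) {n : ℕ} {v : Blocks p m} (hv : v ∈ F n) :
      act (rightPart g) v ∈ F n := by
    have := sub_mem hv (F_anti n (actF_sub hg hv))
    rwa [sub_sub_cancel] at this
  let e : ℕ := if p = 2 then 4 else p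
  have he : p ∣ e := by
    by_cases h2 : p = 2
    · simp only [e, if_pos h2, h2]; norm_num
    · simp only [e, if_neg h2]; exact dvd_rfl
  have he0 : (e : ℤ_[p]) ≠ 0 := by
    have : e ≠ 0 := by
      by_cases h2 : p = 2
      · simp [e, h2]
      · simp [e, h2, (Fact.out : p.Prime).ne_zero]
    exact_mod_cast this
  have hchoose : p ∣ e.choose 2 := by
    by_cases h2 : p = 2
    · simp only [e, if_pos h2, h2]; decide
    · simp only [e, if_neg h2]
      exact (Fact.out : p.Prime).dvd_choose_self (by norm_num)
        (lt_of_le_of_ne (Fact.out : p.Prime).two_le (Ne.symm h2))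
  have key (n : ℕ) : ∀ c ∈ commutator U, (c : GrpG p m) ∈ inclSubgroup (F n) := by
    induction n with
    | zero =>
      have : commutator U ≤ (inclSubgroup (F 0)).subgroupOf U := by
        refine Subgroup.commutator_le.2 fun g _ h _ => ?_
        change ⁅(g : GrpG p m), (h : GrpG p m)⁆ ∈ inclSubgroup (F 0)
        have h1 : ⁅(g : GrpG p m), (h : GrpG p m)⁆ ∈ U := (⁅g, h⁆ : U).2
        rw [commutatorElement_eq_incl] at h1 ⊢
        rw [incl_mem_inclSubgroup]
        refine Submodule.mem_sup_right ⟨(hV _).2 h1, ?_⟩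
        change _ ∈ LinearMap.range (shift p m ^ 0)
        simp [Module.End.one_eq_id]
      exact this
    | succ n ih =>
      have hN : ((inclSubgroup (F (n + 1))).subgroupOf U).Normal :=
        normal_inclSubgroup_subgroupOf fun g hg v hv => actF hg hv
      obtain ⟨K, -, hKc, hK⟩ := exists_subgroup_pow ((inclSubgroup (F (n + 1))).subgroupOf U)
        ((isClosed_inclSubgroup _).preimage continuous_subtype_val) e
        (fun a b k => by
          have h1 := ih ⁅a, b⁆ (Subgroup.commutator_mem_commutator trivial trivial)
          change ⁅((⁅a, b⁆ : U) : GrpG p m), (k : GrpG p m)⁆ ∈ inclSubgroup (F (n + 1))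
          rw [eq_incl_of_rightPart h1.2, commutator_incl, incl_mem_inclSubgroup, ← rightPart_inv]
          exact actF_sub (inv_mem k.2) h1.1)
        (fun a b => by
          have h1 := ih ⁅a, b⁆ (Subgroup.commutator_mem_commutator trivial trivial)
          change ((⁅a, b⁆ : U) : GrpG p m) ^ e.choose 2 ∈ inclSubgroup (F (n + 1))
          rw [eq_incl_of_rightPart h1.2, ← incl_nsmul, incl_mem_inclSubgroup]
          exact Submodule.mem_sup_left (smul_mem_pV hchoose (F_le n h1.1)))
      intro c hc
      have hle : (Subgroup.closure (Set.range fun g : U => g ^ e)).topologicalClosure ≤ K := by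
        refine Subgroup.topologicalClosure_minimal _ ((Subgroup.closure_le _).2 ?_) hKc
        rintro _ ⟨g, rfl⟩
        exact (hK _).2 ⟨g, by rw [inv_mul_cancel]; exact one_mem _⟩
      obtain ⟨g, hg⟩ := (hK c).1 (hle (hpow hc))
      change ((g : GrpG p m) ^ e)⁻¹ * c ∈ inclSubgroup (F (n + 1)) at hg
      have hcr := (ih c hc).2
      have hgr : rightPart (g : GrpG p m) = 0 := by
        have := hg.2
        rw [rightPart_mul, rightPart_inv, rightPart_pow, hcr, add_zero, neg_eq_zero,
          mul_eq_zero] at this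
        exact this.resolve_left he0
      have hge : (g : GrpG p m) ^ e ∈ inclSubgroup (F (n + 1)) := by
        have hgU := g.2
        rw [eq_incl_of_rightPart hgr] at hgU ⊢
        rw [← incl_nsmul, incl_mem_inclSubgroup]
        exact Submodule.mem_sup_left (smul_mem_pV he ((hV _).2 hgU))
      have := mul_mem hge hg
      rwa [mul_inv_cancel_left] at this
  obtain ⟨i, hi⟩ := exists_lowerPSeries_le hU
  have hFle : F (i + blockRank m) ≤ pV := by
    refine sup_le le_rfl ?_
    rintro _ ⟨-, u, rfl⟩
    have h1 (j : Fin m) : ∃ w, ((shift p m ^ blockRank m) u) j = (p : ℤ_[p]) • w := by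
      obtain ⟨w, hw⟩ := shift_pow_div (n := blockRank m) ⟨u, rfl⟩ j
      have hle : 1 ≤ blockRank m / blockRank j :=
        (Nat.one_le_div_iff (blockRank_prime j).pos).2 (blockRank_strictMono.monotone j.2.le)
      obtain ⟨c, hc⟩ := Nat.exists_eq_add_of_le hle
      exact ⟨(p : ℤ_[p]) ^ c • w, by rw [hw, hc, pow_add, mul_smul, pow_one]⟩
    choose w hw using h1
    refine ⟨(shift p m ^ i) w, (hV _).2 (hi ?_), ?_⟩
    · rw [lowerPSeries_eq]
      exact ⟨⟨w, rfl⟩, dvd_zero _⟩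
    · have h2 : (shift p m ^ blockRank m) u = (p : ℤ_[p]) • w := funext hw
      rw [pow_add, Module.End.mul_apply, h2, map_smul]
      rfl
  have h1 := key (i + blockRank m) ⁅g, h⁆ (Subgroup.commutator_mem_commutator trivial trivial)
  exact ⟨hFle h1.1, h1.2⟩

lemma finrank_eq_of_pow_smul_mem {M : Type*} [AddCommGroup M] [Module ℤ_[p] M]
    [Module.Free ℤ_[p] M] [Module.Finite ℤ_[p] M] {D : Submodule ℤ_[p] M} {n : ℕ}
    (h : ∀ v, (p : ℤ_[p]) ^ n • v ∈ D) : Module.finrank ℤ_[p] D = Module.finrank ℤ_[p] M := by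
  refine le_antisymm D.finrank_le ?_
  have hp0 : (p : ℤ_[p]) ≠ 0 := mod_cast (Fact.out : p.Prime).ne_zero
  refine LinearMap.finrank_le_finrank_of_injective
    (f := LinearMap.codRestrict D ((p : ℤ_[p]) ^ n • LinearMap.id) h) fun v w hvw => ?_
  exact smul_right_injective M (pow_ne_zero n hp0) (congrArg Subtype.val hvw)

lemma le_card_of_isPowerful (hU : IsOpen (U : Set (GrpG p m))) (hpow : IsPowerful p U)
    {S : Finset U} (hS : (Subgroup.closure (S : Set U)).topologicalClosure = ⊤) :
    1 + ∑ j : Fin m, blockRank j ≤ S.card := by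
  have hUcl := U.isClosed_of_isOpen hU
  have hUc : CompactSpace U := isCompact_iff_compactSpace.1 hUcl.isCompact
  have hp0 : (p : ℤ_[p]) ≠ 0 := mod_cast (Fact.out : p.Prime).ne_zero
  let V : Submodule ℤ_[p] (Blocks p m) :=
    closedSubmodule (leftSubgroup U) (isClosed_leftSubgroup hUcl)
  let R : Submodule ℤ_[p] ℤ_[p] :=
    closedSubmodule (rightSubgroup U) (isClosed_rightSubgroup hUcl)
  have hV (v) : v ∈ V ↔ incl v ∈ U := Iff.rfl
  set pV := V.map (((p : ℤ_[p]) • (1 : Module.End ℤ_[p] (Blocks p m))) ^ 1) with hpV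
  have hpV' : pV = V.map ((p : ℤ_[p]) • (1 : Module.End ℤ_[p] (Blocks p m))) := by
    rw [hpV, pow_one]
  have mem_pV {v : Blocks p m} : v ∈ pV ↔ ∃ w ∈ V, (p : ℤ_[p]) • w = v := by
    rw [hpV']
    exact Iff.rfl
  have hcomm (g h : U) : ⁅(g : GrpG p m), (h : GrpG p m)⁆ ∈ inclSubgroup pV := by
    rw [hpV']
    exact commutator_mem_smul_of_isPowerful hU hpow hV g h
  set X := (inclSubgroup pV).subgroupOf U with hX
  have actV {g : GrpG p m} (hg : g ∈ U) {v : Blocks p m} (hv : v ∈ V) :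
      act (rightPart g) v ∈ V := by
    have := mul_mem (mul_mem (inv_mem hg) ((hV v).1 hv)) (inv_mem (inv_mem hg))
    rwa [conj_incl, rightPart_inv, neg_neg, ← hV] at this
  have hXn : X.Normal := normal_inclSubgroup_subgroupOf fun g hg v hv => by
    obtain ⟨w, hw, rfl⟩ := mem_pV.1 hv
    exact mem_pV.2 ⟨_, actV hg hw, (map_smul _ _ _).symm⟩
  have hXcomm (a b : U) : ⁅a, b⁆ ∈ X := hcomm a b
  obtain ⟨K, hKn, hKc, hK⟩ := exists_subgroup_pow X
    ((isClosed_inclSubgroup _).preimage continuous_subtype_val) p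
    (fun a b k => hXcomm _ _) (fun a b => pow_mem (hXcomm a b) _)
  have hKX {g : U} (hg : g ∈ X) : g ∈ K := (hK g).2 ⟨1, by simpa using hg⟩
  have hKp (g : U) : g ^ p ∈ K := (hK _).2 ⟨g, by rw [inv_mul_cancel]; exact one_mem _⟩
  have hK1 : ((K.map U.subtype).subgroupOf U).Normal := by
    rwa [Subgroup.subgroupOf, Subgroup.comap_map_eq_self_of_injective U.subtype_injective]
  have hindex : K.index = (K.map U.subtype).relIndex U := by
    rw [Subgroup.relIndex, Subgroup.subgroupOf,
      Subgroup.comap_map_eq_self_of_injective U.subtype_injective]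
  have hr : rightSubgroup (K.map U.subtype ⊓ U) =
      (R.map (((p : ℤ_[p]) • (1 : Module.End ℤ_[p] ℤ_[p])) ^ 1)).toAddSubgroup := by
    rw [pow_one]
    ext z
    constructor
    · rintro ⟨_, ⟨⟨g, hg, rfl⟩, -⟩, rfl⟩
      obtain ⟨h, hh⟩ := (hK g).1 hg
      refine ⟨rightPart (h : GrpG p m), ⟨h, h.2, rfl⟩, ?_⟩
      have := hh.2
      change rightPart (((h : GrpG p m) ^ p)⁻¹ * (g : GrpG p m)) = 0 at this
      rw [rightPart_mul, rightPart_inv, rightPart_pow, neg_add_eq_zero] at this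
      exact this
    · rintro ⟨_, ⟨g, hg, rfl⟩, rfl⟩
      exact ⟨g ^ p, ⟨⟨⟨g, hg⟩ ^ p, hKp _, rfl⟩, pow_mem hg p⟩, rightPart_pow g p⟩
  have hl : leftSubgroup (K.map U.subtype) = pV.toAddSubgroup := by
    ext v
    constructor
    · rintro ⟨g, hg, hgv⟩
      change (g : GrpG p m) = incl v at hgv
      obtain ⟨h, hh⟩ := (hK g).1 hg
      change ((h : GrpG p m) ^ p)⁻¹ * (g : GrpG p m) ∈ inclSubgroup pV at hh
      rw [hgv] at hh
      have h0 : rightPart (h : GrpG p m) = 0 := by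
        have := hh.2
        rw [rightPart_mul, rightPart_inv, rightPart_pow, rightPart_incl, add_zero, neg_eq_zero,
          mul_eq_zero] at this
        exact this.resolve_left hp0
      have hhU := h.2
      rw [eq_incl_of_rightPart h0, ← incl_nsmul, ← incl_neg, ← incl_add,
        incl_mem_inclSubgroup] at hh
      rw [eq_incl_of_rightPart h0] at hhU
      have h1 : p • leftPart (h : GrpG p m) ∈ pV :=
        mem_pV.2 ⟨_, (hV _).2 hhU, Nat.cast_smul_eq_nsmul _ _ _⟩
      have := add_mem h1 hh
      rwa [add_neg_cancel_left] at this
    · intro hv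
      obtain ⟨w, hw, rfl⟩ := mem_pV.1 hv
      exact ⟨⟨_, (hV _).1 (V.smul_mem _ hw)⟩, hKX ⟨hv, rfl⟩, rfl⟩
  obtain ⟨i, hi⟩ := exists_lowerPSeries_le hU
  have hVrank : Module.finrank ℤ_[p] V = ∑ j : Fin m, blockRank j := by
    rw [← finrank_blocks (p := p)]
    refine finrank_eq_of_pow_smul_mem (n := i) fun v => (hV _).2 (hi ?_)
    rw [lowerPSeries_eq]
    exact ⟨pow_smul_mem_range_shift fun j =>
      Or.inr (Nat.le_mul_of_pos_left i (blockRank_prime j).pos), dvd_zero _⟩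
  have hRrank : Module.finrank ℤ_[p] R = 1 := by
    rw [← Module.finrank_self ℤ_[p]]
    refine finrank_eq_of_pow_smul_mem (n := i) fun z =>
      ⟨SemidirectProduct.inr (.ofAdd ((p : ℤ_[p]) ^ i • z)), hi ?_, rfl⟩
    rw [lowerPSeries_eq]
    exact ⟨zero_mem _, by rw [zero_add]; exact Dvd.intro z rfl⟩
  have hKi : K.index = p ^ (1 + ∑ j : Fin m, blockRank j) := by
    have h1 : rightSubgroup U = R.toAddSubgroup := rfl
    have h2 : leftSubgroup U = V.toAddSubgroup := rfl
    rw [hindex, relIndex_eq_left_mul_right, hr, hl, h1, h2, relIndex_pow_smul, relIndex_pow_smul,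
      hVrank, hRrank, mul_one, mul_one, pow_add]
  have hKf : K.FiniteIndex := ⟨by rw [hKi]; exact (pow_pos (Fact.out : p.Prime).pos _).ne'⟩
  have hdvd := index_dvd_of_topological_generators K hKc (fun a b => hKX (hXcomm a b)) hKp hS
  rw [hKi] at hdvd
  exact (Nat.pow_dvd_pow_iff_le_right (Fact.out : p.Prime).one_lt).1 hdvd

variable (p m)

lemma topRank_uniformSubgroup :
    topRank (uniformSubgroup p m) = 1 + ∑ j : Fin m, blockRank j := by
  obtain ⟨S, hS, hgen⟩ := exists_generators_uniformSubgroup p m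
  have hmem : S.card ∈ topGenCards (uniformSubgroup p m) := ⟨S, rfl, hgen⟩
  refine le_antisymm ((Nat.sInf_le hmem).trans hS) (le_csInf ⟨_, hmem⟩ ?_)
  rintro _ ⟨T, rfl, hT⟩
  exact le_card_of_isPowerful isOpen_uniformSubgroup isPowerful_uniformSubgroup hT

lemma topRank_mem_uniformRanks :
    1 + ∑ j : Fin m, blockRank j ∈ uniformRanks p (GrpG p m) :=
  ⟨_, isOpen_uniformSubgroup, isUniform_uniformSubgroup p m, topRank_uniformSubgroup p m⟩

lemma isPadicAnalyticProP_grpG : IsPadicAnalyticProP p (GrpG p m) :=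
  ⟨isProP_grpG p m, _, topRank_mem_uniformRanks p m⟩

lemma padicDim_grpG : padicDim p (GrpG p m) = 1 + ∑ j : Fin m, blockRank j := by
  refine le_antisymm (Nat.sInf_le (topRank_mem_uniformRanks p m))
    (le_csInf ⟨_, topRank_mem_uniformRanks p m⟩ ?_)
  rintro _ ⟨U, hU, hunif, rfl⟩
  refine le_csInf hunif.finitelyGenerated ?_
  rintro _ ⟨S, rfl, hS⟩
  exact le_card_of_isPowerful hU hunif.isPowerful hS

lemma derivedSeries_two_grpG : derivedSeries (GrpG p m) 2 = ⊥ := by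
  have h1 : derivedSeries (GrpG p m) 1 ≤ inclSubgroup ⊤ :=
    Subgroup.commutator_le.2 fun g _ h _ => by
      rw [commutatorElement_eq_incl, incl_mem_inclSubgroup]
      trivial
  refine (Subgroup.eq_bot_iff_forall _).2 fun g hg => ?_
  refine (Subgroup.commutator_le (H₃ := ⊥)).2 (fun a ha b hb => ?_) hg
  rw [eq_incl_of_rightPart (h1 ha).2, commutator_incl, (h1 hb).2, neg_zero, act_zero]
  simp only [Module.End.one_apply, sub_self]
  exact rfl

end PowerfulSubgroups

end HSpec

theorem mainTheorem7 (p : ℕ) [Fact p.Prime] :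
    (∀ m : ℕ, 1 ≤ m →
      HSpec.IsPadicAnalyticProP p (HSpec.GrpG p m) ∧
      derivedSeries (HSpec.GrpG p m) 2 = ⊥ ∧
      HSpec.padicDim p (HSpec.GrpG p m) = 1 + ∑ j : Fin m, HSpec.blockRank j ∧
      (∀ B : (j : Fin m) → Submodule ℤ_[p] (Fin (HSpec.blockRank j) → ℤ_[p]),
        HSpec.hdim p (HSpec.lowerPSeries p (HSpec.GrpG p m)) (HSpec.prodSubgroup p B) =
          (∑ j : Fin m, (Module.finrank ℤ_[p] (B j) : ℝ) / (HSpec.blockRank j : ℝ)) /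
            ((m : ℝ) + 1)) ∧
      (HSpec.hspec p (HSpec.GrpG p m)).Finite ∧
      ∏ j : Fin m, HSpec.blockRank j ≤ (HSpec.hspec p (HSpec.GrpG p m)).ncard ∧
      (HSpec.hspec p (HSpec.GrpG p m)).ncard ≤ 2 * ∏ j : Fin m, (HSpec.blockRank j + 1)) ∧
    Asymptotics.IsEquivalent atTop
      (fun m : ℕ => Real.log ((HSpec.hspec p (HSpec.GrpG p m)).ncard : ℝ))
      (fun m : ℕ => Real.log (∏ j : Fin m, (HSpec.blockRank j : ℝ))) ∧
    Tendsto (fun m : ℕ =>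
        Real.logb p ((HSpec.hspec p (HSpec.GrpG p m)).ncard : ℝ) /
          √(HSpec.padicDim p (HSpec.GrpG p m) : ℝ))
      atTop atTop :=
  ⟨fun m _ => ⟨HSpec.isPadicAnalyticProP_grpG p m, HSpec.derivedSeries_two_grpG p m,
    HSpec.padicDim_grpG p m, HSpec.hdim_prodSubgroup, HSpec.finite_hspec p m,
    HSpec.prod_blockRank_le_ncard_hspec p m, HSpec.ncard_hspec_le p m⟩,
    HSpec.isEquivalent_log_ncard_hspec p,
    HSpec.tendsto_logb_ncard_hspec p fun m _ => HSpec.padicDim_grpG p m⟩
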